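/- Let $a,h_0>0$ and $\dot h_0\neq 0$. Let $b:\mathbb R\to\mathbb R$ be locally Lipschitz with $b(y)y>0$ for all $y\ne0$, and suppose that $B(y):=\int_0^y b(w)\,dw\to\infty$ as $|y|\to\infty$. Let $\mathcal D:(0,\infty)\times\mathbb R\to(0,\infty)$ be locally Lipschitz, and assume: * there are $c>0$ and $\alpha\in[1,\infty)$ with $\mathcal D(h,\xi)\ge c\,h^{-\alpha}$ for all $h>0$, $\xi\in\mathbb R$; * $\mathcal D(h,\xi_1)\le\mathcal D(h,\xi_2)$ for all $h>0$ and $\xi_1\le\xi_2$; * there are $\delta_1,c_1>0$ and $\gamma_1\in[\alpha,\infty)$ with $\mathcal D(h,-\delta_1)\ge c_1h^{-\gamma_1}$ for all $h>0$; * there are $\delta_2>0$ and $\gamma:(0,\infty)\to[0,\infty)$, with $y\mapsto\gamma(y)/y$ integrable near $0$ and $\int_0^h\gamma(y)y^{-1}\,dy\to0$ as $h\to0^+$, such that $\mathcal D(h,-\delta_2)\le\gamma(h)h^{-\gamma_1}$ for all $h>0$. Then there is a unique $y^-<0$ with $2aB(y^-)=\dot h_0^2$. Assume moreover that $y^-<-\delta_2$.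 For $\mu>0$ consider global solutions $(h_\mu,\xi_\mu)$ on $[0,\infty)$, with $h_\mu>0$, of $$\ddot h-\ddot\xi=a\,b(\xi),\qquad \ddot h=-b(\xi)-\mu\,\mathcal D(h,\xi)\,\dot h,$$ $$h(0)=h_0,\quad \dot h(0)=\dot h_0,\quad \xi(0)=0,\quad \dot\xi(0)=0.$$ Put $t_0:=-h_0/\dot h_0$. Then for every sequence $\mu_n>0$ with $\mu_n\to0$, writing $h_n:=h_{\mu_n}$, there is a time $T>0$ with $T>t_0$ such that $$\liminf_{n\to\infty}h_n(T)>0,$$ and $h_{n}(T)$ converges to a positive limit along some subsequence. (In particular $\lim_{n\to\infty}h_n(T)>0$ whenever this limit exists, for example whenever $h_n$ converges pointwise.) -/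

import Mathlib

open Set Filter Topology MeasureTheory

/-- The elastic potential `B(y) = ∫₀^y b(w) dw`. -/
noncomputable def elasticPotential (b : ℝ → ℝ) (y : ℝ) : ℝ :=
  ∫ w in (0 : ℝ)..y, b w

/-- `(h, ξ)` is a global (classical) solution on `[0, ∞)`, with `h > 0`, of the system
`h'' - ξ'' = a b(ξ)`, `h'' = - b(ξ) - μ D(h, ξ) h'` with initial data
`h(0) = h₀`, `h'(0) = v₀`, `ξ(0) = ξ₀`, `ξ'(0) = w₀`.
The functions `v` and `w` are the first derivatives of `h` and `ξ`; derivatives at `t = 0` are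
one-sided, and values at negative times play no role. -/
def IsGlobalSolution (a μ : ℝ) (b : ℝ → ℝ) (D : ℝ → ℝ → ℝ) (h₀ v₀ ξ₀ w₀ : ℝ)
    (h ξ : ℝ → ℝ) : Prop :=
  (∀ t, 0 ≤ t → 0 < h t) ∧
  ∃ v w : ℝ → ℝ,
    (∀ t, 0 ≤ t → HasDerivWithinAt h (v t) (Ici 0) t) ∧
    (∀ t, 0 ≤ t → HasDerivWithinAt ξ (w t) (Ici 0) t) ∧
    (∀ t, 0 ≤ t → HasDerivWithinAt (fun s => v s - w s) (a * b (ξ t)) (Ici 0) t) ∧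
    (∀ t, 0 ≤ t →
      HasDerivWithinAt v (-b (ξ t) - μ * D (h t) (ξ t) * v t) (Ici 0) t) ∧
    h 0 = h₀ ∧ v 0 = v₀ ∧ ξ 0 = ξ₀ ∧ w 0 = w₀

/-!
For small viscosity `μ` the drag is only felt near the wall `h = 0`, and the bounds provided by the
energy `u² / (2a) + v² / 2 + B(ξ)`, with `v = h'` and `u = h' - ξ'`, make `h`, `ξ` and `u`
equi-Lipschitz. If `h_n(T)` had lower limit zero, these functions would converge locally uniformly
along an ultrafilter to limits with `(h - ξ)' = u`, `u' = a b(ξ)` and `h(T) = 0`. For `v₀ < 0` and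
`T` large this is contradictory (for `v₀ > 0` any short time `T` will do).

* *Approach.* Until the contact time `t₀ = -h₀ / v₀` the limit is the free flight
  `h = h₀ + v₀ t`, `ξ = 0`, since momentum is asymptotically conserved away from the wall and the
  initial state has the least energy for its momentum (`IsVanishingLimit.free_flight`).
* *Rest.* Let `S ≥ t₀` be the last time up to which `h = 0`. On `[t₀, S]` the deformation oscillates
  by `ξ'' = -a b(ξ)`: it is first compressed, then descends through `0` towards `y⁻`. A phase angle
  and the conserved energy bound the time this takes until a level `-δ` with `y⁻ < -δ < -δ₂`
  (`compression_time_le`, `exists_descent`).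
* *Rebound.* The body cannot still rest at the wall when `ξ < -δ₂`
  (`IsVanishingLimit.false_of_stuck`). The drag impulse received while `ξ > -δ₁` bounds
  `μ h ^ (1 - γ₁)` (`mul_rpow_le`). Once `ξ < 0`, the elastic force makes the body ascend
  (`velocity_nonneg`), and for `ξ < -δ₂` the drag impulse is then at most a constant times
  `∫ γ(y) / y dy` over the small heights passed, hence negligible against the elastic force
  (`le_velocity`). So `S < T`.
* *No return.* The limit leaves the wall only with velocity zero (`hasDerivAt_of_excursion`), hence
  not while the spring is compressed (`false_of_excursion_of_nonneg`), and conservation of energy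
  and momentum prevent a body that has left it with an extended spring from coming back
  (`false_of_return`), so `h(T) ≠ 0` (`height_ne_zero`).
-/

/-! ### Mean value inequalities -/

lemma le_add_of_hasDerivAt_le {f f' : ℝ → ℝ} {a b C : ℝ} (hab : a ≤ b)
    (hc : ContinuousOn f (Icc a b)) (hd : ∀ t ∈ Ioo a b, HasDerivAt f (f' t) t)
    (hC : ∀ t ∈ Ioo a b, f' t ≤ C) : f b ≤ f a + C * (b - a) := by
  rcases hab.eq_or_lt with rfl | hlt
  · simp
  obtain ⟨t, ht, hs⟩ := exists_hasDerivAt_eq_slope f f' hlt hc hd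
  have h1 := hC t ht
  rw [hs, div_le_iff₀ (sub_pos.2 hlt)] at h1
  linarith

lemma add_le_of_le_hasDerivAt {f f' : ℝ → ℝ} {a b C : ℝ} (hab : a ≤ b)
    (hc : ContinuousOn f (Icc a b)) (hd : ∀ t ∈ Ioo a b, HasDerivAt f (f' t) t)
    (hC : ∀ t ∈ Ioo a b, C ≤ f' t) : f a + C * (b - a) ≤ f b := by
  rcases hab.eq_or_lt with rfl | hlt
  · simp
  obtain ⟨t, ht, hs⟩ := exists_hasDerivAt_eq_slope f f' hlt hc hd
  have h1 := hC t ht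
  rw [hs, le_div_iff₀ (sub_pos.2 hlt)] at h1
  linarith

lemma hasDerivAt_of_hasDerivWithinAt_Ici {f : ℝ → ℝ} {f' t : ℝ}
    (h : HasDerivWithinAt f f' (Ici 0) t) (ht : 0 < t) : HasDerivAt f f' t :=
  h.hasDerivAt (Ici_mem_nhds ht)

/-! ### The elastic potential -/

section potential

variable {b : ℝ → ℝ}

lemma hasDerivAt_elasticPotential (hb : Continuous b) (y : ℝ) :
    HasDerivAt (elasticPotential b) (b y) y :=
  intervalIntegral.integral_hasDerivAt_right (hb.intervalIntegrable _ _)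
    hb.stronglyMeasurable.stronglyMeasurableAtFilter hb.continuousAt

lemma continuous_elasticPotential (hb : Continuous b) : Continuous (elasticPotential b) :=
  continuous_iff_continuousAt.2 fun y => (hasDerivAt_elasticPotential hb y).continuousAt

@[simp] lemma elasticPotential_zero : elasticPotential b 0 = 0 := by
  simp [elasticPotential]

lemma pos_of_sign (hs : ∀ y : ℝ, y ≠ 0 → 0 < b y * y) {y : ℝ} (hy : 0 < y) : 0 < b y :=
  pos_of_mul_pos_left (hs y hy.ne') hy.le

lemma neg_of_sign (hs : ∀ y : ℝ, y ≠ 0 → 0 < b y * y) {y : ℝ} (hy : y < 0) : b y < 0 := by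
  by_contra h
  have := hs y hy.ne
  nlinarith

lemma zero_of_sign (hb : Continuous b) (hs : ∀ y : ℝ, y ≠ 0 → 0 < b y * y) : b 0 = 0 := by
  apply le_antisymm
  · refine le_of_tendsto (x := 𝓝[<] (0 : ℝ)) (hb.continuousAt.tendsto.mono_left nhdsWithin_le_nhds) ?_
    filter_upwards [self_mem_nhdsWithin] with y hy using (neg_of_sign hs hy).le
  · refine ge_of_tendsto (x := 𝓝[>] (0 : ℝ)) (hb.continuousAt.tendsto.mono_left nhdsWithin_le_nhds) ?_
    filter_upwards [self_mem_nhdsWithin] with y hy using (pos_of_sign hs hy).le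

lemma nonneg_of_sign (hb : Continuous b) (hs : ∀ y : ℝ, y ≠ 0 → 0 < b y * y) {y : ℝ}
    (hy : 0 ≤ y) : 0 ≤ b y := by
  rcases hy.eq_or_lt with rfl | h
  · exact (zero_of_sign hb hs).ge
  · exact (pos_of_sign hs h).le

lemma strictMonoOn_elasticPotential (hb : Continuous b) (hs : ∀ y : ℝ, y ≠ 0 → 0 < b y * y) :
    StrictMonoOn (elasticPotential b) (Ici 0) := by
  apply strictMonoOn_of_deriv_pos (convex_Ici 0) (continuous_elasticPotential hb).continuousOn
  intro x hx
  rw [interior_Ici] at hx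
  rw [(hasDerivAt_elasticPotential hb x).deriv]
  exact pos_of_sign hs hx

lemma strictAntiOn_elasticPotential (hb : Continuous b) (hs : ∀ y : ℝ, y ≠ 0 → 0 < b y * y) :
    StrictAntiOn (elasticPotential b) (Iic 0) := by
  apply strictAntiOn_of_deriv_neg (convex_Iic 0) (continuous_elasticPotential hb).continuousOn
  intro x hx
  rw [interior_Iic] at hx
  rw [(hasDerivAt_elasticPotential hb x).deriv]
  exact neg_of_sign hs hx

lemma elasticPotential_pos (hb : Continuous b) (hs : ∀ y : ℝ, y ≠ 0 → 0 < b y * y) {y : ℝ}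
    (hy : y ≠ 0) : 0 < elasticPotential b y := by
  rw [← elasticPotential_zero (b := b)]
  rcases hy.lt_or_gt with h | h
  · exact strictAntiOn_elasticPotential hb hs h.le self_mem_Iic h
  · exact strictMonoOn_elasticPotential hb hs self_mem_Ici h.le h

lemma elasticPotential_nonneg (hb : Continuous b) (hs : ∀ y : ℝ, y ≠ 0 → 0 < b y * y) (y : ℝ) :
    0 ≤ elasticPotential b y := by
  by_cases hy : y = 0
  · simp [hy]
  · exact (elasticPotential_pos hb hs hy).le

/-- Coercivity makes the sublevel sets of the potential bounded. -/
lemma exists_abs_le_of_elasticPotential_le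
    (hB : Tendsto (elasticPotential b) (cocompact ℝ) atTop) (M : ℝ) :
    ∃ X : ℝ, 0 < X ∧ ∀ y, elasticPotential b y ≤ M → |y| ≤ X := by
  have h := hB.eventually_gt_atTop M
  rw [← Metric.cobounded_eq_cocompact, ← comap_norm_atTop, eventually_comap] at h
  obtain ⟨R, hR⟩ := h.exists_forall_of_atTop
  refine ⟨max R 1, by positivity, fun y hy => ?_⟩
  by_contra hlt
  exact absurd hy (not_le.2 (hR |y| ((le_max_left _ _).trans (not_le.1 hlt).le) y rfl))

lemma existsUnique_neg_elasticPotential_eq (hb : Continuous b)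
    (hs : ∀ y : ℝ, y ≠ 0 → 0 < b y * y)
    (hB : Tendsto (elasticPotential b) (cocompact ℝ) atTop) {a v₀ : ℝ} (ha : 0 < a)
    (hv₀ : v₀ ≠ 0) :
    ∃! y : ℝ, y < 0 ∧ 2 * a * elasticPotential b y = v₀ ^ 2 := by
  have hv : 0 < v₀ ^ 2 := by positivity
  obtain ⟨X, hX, hX'⟩ := exists_abs_le_of_elasticPotential_le hB (v₀ ^ 2 / (2 * a))
  have h1 : v₀ ^ 2 / (2 * a) < elasticPotential b (-(X + 1)) := by
    by_contra h
    have := hX' _ (not_lt.1 h)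
    rw [abs_neg, abs_of_pos (by linarith)] at this
    linarith
  obtain ⟨y, hy, hy'⟩ := intermediate_value_Icc' (by linarith : -(X + 1) ≤ 0)
    (continuous_elasticPotential hb).continuousOn
    (show v₀ ^ 2 / (2 * a) ∈ Icc (elasticPotential b 0) (elasticPotential b (-(X + 1))) from
      ⟨by rw [elasticPotential_zero]; positivity, h1.le⟩)
  have hy2 : 2 * a * elasticPotential b y = v₀ ^ 2 := by rw [hy']; field_simp
  refine ⟨y, ⟨lt_of_le_of_ne hy.2 ?_, hy2⟩, ?_⟩
  · rintro rfl
    rw [elasticPotential_zero, mul_zero] at hy2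
    exact hv.ne hy2
  · rintro z ⟨hz, hz2⟩
    apply (strictAntiOn_elasticPotential hb hs).injOn hz.le hy.2
    have : 2 * a * elasticPotential b z = 2 * a * elasticPotential b y := hz2.trans hy2.symm
    exact mul_left_cancel₀ (by positivity) this

end potential

/-! ### Trajectories and their energy bounds -/

/-- A trajectory on `[0, ∞)` written as a first-order system: `v` is the velocity of `h`, and `u`
is the velocity of `h - ξ`, so that `ξ` has velocity `v - u`. It starts from the unstrained state
`ξ = 0`, `ξ' = 0` at height `h₀` with velocity `v₀`. -/
structure IsTrajectory (a μ : ℝ) (b : ℝ → ℝ) (D : ℝ → ℝ → ℝ) (h₀ v₀ : ℝ)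
    (h ξ v u : ℝ → ℝ) : Prop where
  pos : ∀ t, 0 ≤ t → 0 < h t
  deriv_h : ∀ t, 0 ≤ t → HasDerivWithinAt h (v t) (Ici 0) t
  deriv_ξ : ∀ t, 0 ≤ t → HasDerivWithinAt ξ (v t - u t) (Ici 0) t
  deriv_u : ∀ t, 0 ≤ t → HasDerivWithinAt u (a * b (ξ t)) (Ici 0) t
  deriv_v : ∀ t, 0 ≤ t → HasDerivWithinAt v (-b (ξ t) - μ * D (h t) (ξ t) * v t) (Ici 0) t
  h_zero : h 0 = h₀
  v_zero : v 0 = v₀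
  ξ_zero : ξ 0 = 0
  u_zero : u 0 = v₀

lemma IsGlobalSolution.exists_isTrajectory {a μ : ℝ} {b : ℝ → ℝ} {D : ℝ → ℝ → ℝ} {h₀ v₀ : ℝ}
    {h ξ : ℝ → ℝ} (H : IsGlobalSolution a μ b D h₀ v₀ 0 0 h ξ) :
    ∃ v u : ℝ → ℝ, IsTrajectory a μ b D h₀ v₀ h ξ v u := by
  obtain ⟨hpos, v, w, h1, h2, h3, h4, e1, e2, e3, e4⟩ := H
  refine ⟨v, fun t => v t - w t, hpos, h1, ?_, h3, h4, e1, e2, e3, by simp [e2, e4]⟩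
  intro t ht
  simpa using h2 t ht

/-- Two-sided fencing for the maximum of two functions: at each time only the larger one has to
grow at rate at most `C`. -/
lemma max_le_add_of_deriv_le {f g f' g' : ℝ → ℝ} {a b C : ℝ} (hab : a ≤ b)
    (hf : ContinuousOn f (Icc a b)) (hg : ContinuousOn g (Icc a b))
    (hf' : ∀ t ∈ Ico a b, HasDerivWithinAt f (f' t) (Ici t) t)
    (hg' : ∀ t ∈ Ico a b, HasDerivWithinAt g (g' t) (Ici t) t)
    (hfC : ∀ t ∈ Ico a b, g t ≤ f t → f' t ≤ C) (hgC : ∀ t ∈ Ico a b, f t ≤ g t → g' t ≤ C) :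
    max (f b) (g b) ≤ max (f a) (g a) + C * (b - a) := by
  have key := image_le_of_liminf_slope_right_le_deriv_boundary (f := fun t => max (f t) (g t))
    (a := a) (b := b) (hf.sup hg) (B := fun t => max (f a) (g a) + C * (t - a)) (B' := fun _ => C)
    (by simp) (by fun_prop) (fun t _ => by
      simpa using ((((hasDerivAt_id t).sub_const a).const_mul C).const_add
        (max (f a) (g a))).hasDerivWithinAt (s := Ici t)) ?_
    (right_mem_Icc.2 hab)
  · exact key
  intro t ht r hr
  apply Eventually.frequently
  have slope_lt : ∀ {k k' : ℝ → ℝ}, HasDerivWithinAt k (k' t) (Ici t) t → k' t ≤ C →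
      ∀ᶠ z in 𝓝[>] t, k z < k t + r * (z - t) := by
    intro k k' hk hkC
    have h1 := (hk.mono Ioi_subset_Ici_self).limsup_slope_le' (lt_irrefl t)
      (lt_of_le_of_lt hkC hr)
    filter_upwards [h1, self_mem_nhdsWithin] with z hz hz2
    rw [slope_def_field, div_lt_iff₀ (sub_pos.2 hz2)] at hz
    linarith
  have cf : Tendsto f (𝓝[>] t) (𝓝 (f t)) :=
    (hf' t ht).continuousWithinAt.tendsto.mono_left (nhdsWithin_mono _ Ioi_subset_Ici_self)
  have cg : Tendsto g (𝓝[>] t) (𝓝 (g t)) :=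
    (hg' t ht).continuousWithinAt.tendsto.mono_left (nhdsWithin_mono _ Ioi_subset_Ici_self)
  have goal : ∀ᶠ z in 𝓝[>] t, max (f z) (g z) < max (f t) (g t) + r * (z - t) := by
    rcases lt_trichotomy (f t) (g t) with h | h | h
    · filter_upwards [slope_lt (hg' t ht) (hgC t ht h.le), cf.eventually_lt cg h] with z h1 h2
      rw [max_eq_right h2.le, max_eq_right h.le]; exact h1
    · filter_upwards [slope_lt (hg' t ht) (hgC t ht h.le), slope_lt (hf' t ht) (hfC t ht h.ge)]
        with z h1 h2
      rw [h, max_self]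
      exact max_lt (h ▸ h2) h1
    · filter_upwards [slope_lt (hf' t ht) (hfC t ht h.le), cg.eventually_lt cf h] with z h1 h2
      rw [max_eq_left h2.le, max_eq_left h.le]; exact h1
  filter_upwards [goal, self_mem_nhdsWithin] with z hz hz2
  rw [slope_def_field, div_lt_iff₀ (sub_pos.2 hz2)]
  linarith

namespace IsTrajectory

variable {a μ : ℝ} {b : ℝ → ℝ} {D : ℝ → ℝ → ℝ} {h₀ v₀ : ℝ} {h ξ v u : ℝ → ℝ}

lemma continuousOn_h (H : IsTrajectory a μ b D h₀ v₀ h ξ v u) : ContinuousOn h (Ici 0) :=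
  fun t ht => (H.deriv_h t ht).continuousWithinAt

lemma continuousOn_ξ (H : IsTrajectory a μ b D h₀ v₀ h ξ v u) : ContinuousOn ξ (Ici 0) :=
  fun t ht => (H.deriv_ξ t ht).continuousWithinAt

lemma continuousOn_u (H : IsTrajectory a μ b D h₀ v₀ h ξ v u) : ContinuousOn u (Ici 0) :=
  fun t ht => (H.deriv_u t ht).continuousWithinAt

lemma continuousOn_v (H : IsTrajectory a μ b D h₀ v₀ h ξ v u) : ContinuousOn v (Ici 0) :=
  fun t ht => (H.deriv_v t ht).continuousWithinAt

/-- The drag dissipates the energy `u² / (2a) + v² / 2 + B(ξ)`. -/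
lemma energy_le (H : IsTrajectory a μ b D h₀ v₀ h ξ v u) (ha : 0 < a) (hμ : 0 < μ)
    (hb : Continuous b) (hD : ∀ x y : ℝ, 0 < x → 0 < D x y) {t : ℝ} (ht : 0 ≤ t) :
    u t ^ 2 / (2 * a) + v t ^ 2 / 2 + elasticPotential b (ξ t) ≤
      v₀ ^ 2 / (2 * a) + v₀ ^ 2 / 2 := by
  have key := le_add_of_hasDerivAt_le
    (f := fun t => u t ^ 2 / (2 * a) + v t ^ 2 / 2 + elasticPotential b (ξ t))
    (f' := fun t => -(μ * D (h t) (ξ t) * v t ^ 2)) (C := 0) ht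
    (((((H.continuousOn_u.pow 2).div_const _).add ((H.continuousOn_v.pow 2).div_const _)).add
      ((continuous_elasticPotential hb).comp_continuousOn H.continuousOn_ξ)).mono
        Icc_subset_Ici_self) ?_ ?_
  · simpa [H.u_zero, H.v_zero, H.ξ_zero] using key
  · intro s hs
    have du := hasDerivAt_of_hasDerivWithinAt_Ici (H.deriv_u s hs.1.le) hs.1
    have dv := hasDerivAt_of_hasDerivWithinAt_Ici (H.deriv_v s hs.1.le) hs.1
    have dξ := hasDerivAt_of_hasDerivWithinAt_Ici (H.deriv_ξ s hs.1.le) hs.1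
    refine ((((du.pow 2).div_const (2 * a)).add ((dv.pow 2).div_const 2)).add
      ((hasDerivAt_elasticPotential hb (ξ s)).comp s dξ)).congr_deriv ?_
    field_simp
    ring
  · intro s hs
    have := hD (h s) (ξ s) (H.pos s hs.1.le)
    have : 0 ≤ μ * D (h s) (ξ s) * v s ^ 2 := by positivity
    linarith

/-- Energy dissipation and coercivity bound velocities, deformation and elastic force, uniformly
in time and in the viscosity. -/
lemma exists_uniform_bounds (ha : 0 < a) (hb : Continuous b)
    (hs : ∀ y : ℝ, y ≠ 0 → 0 < b y * y) (hB : Tendsto (elasticPotential b) (cocompact ℝ) atTop)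
    (hD : ∀ x y : ℝ, 0 < x → 0 < D x y) (h₀ v₀ : ℝ) :
    ∃ V X C : ℝ, 0 < V ∧ 0 < X ∧ 0 < C ∧ (∀ x, |x| ≤ X → |b x| ≤ C) ∧
      ∀ μ : ℝ, 0 < μ → ∀ h ξ v u : ℝ → ℝ, IsTrajectory a μ b D h₀ v₀ h ξ v u →
        ∀ t, 0 ≤ t → |v t| ≤ V ∧ |u t| ≤ V ∧ |ξ t| ≤ X := by
  set E := v₀ ^ 2 / (2 * a) + v₀ ^ 2 / 2 with hE
  have hE0 : 0 ≤ E := by positivity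
  obtain ⟨X, hX, hX'⟩ := exists_abs_le_of_elasticPotential_le hB E
  obtain ⟨C, hC⟩ := (isCompact_Icc (a := -X) (b := X)).exists_bound_of_continuousOn hb.continuousOn
  refine ⟨1 + 2 * E + 2 * a * E, X, max C 1, by positivity, hX, by positivity, fun x hx =>
    (hC x (abs_le.1 hx)).trans (le_max_left _ _), ?_⟩
  intro μ hμ h ξ v u H t ht
  have h1 := H.energy_le ha hμ hb hD ht
  rw [← hE] at h1
  have h2 := elasticPotential_nonneg hb hs (ξ t)
  have h3 : 0 ≤ u t ^ 2 / (2 * a) := by positivity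
  have h4 : 0 ≤ v t ^ 2 / 2 := by positivity
  have h5 : u t ^ 2 ≤ 2 * a * E := by
    have : u t ^ 2 / (2 * a) ≤ E := by linarith
    rw [div_le_iff₀ (by positivity)] at this
    linarith
  have h6 : 0 ≤ a * E := by positivity
  refine ⟨?_, ?_, hX' _ (by linarith)⟩
  · apply abs_le_of_sq_le_sq _ (by positivity)
    nlinarith
  · apply abs_le_of_sq_le_sq _ (by positivity)
    nlinarith

/-! ### One-sided control of the velocity -/

/-- The drag opposes the motion, so a nonnegative velocity grows at most at the rate of the
elastic force. -/
lemma velocity_le (H : IsTrajectory a μ b D h₀ v₀ h ξ v u) (hμ : 0 < μ)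
    (hD : ∀ x y : ℝ, 0 < x → 0 < D x y) {C m x t : ℝ} (hx : 0 ≤ x) (hxt : x ≤ t) (hm : 0 ≤ m)
    (hC : 0 ≤ C) (hbC : ∀ s ∈ Icc x t, -b (ξ s) < C) (hv : v x ≤ m) :
    v t ≤ m + C * (t - x) := by
  refine image_le_of_deriv_right_lt_deriv_boundary
    (H.continuousOn_v.mono fun s hs => hx.trans hs.1)
    (fun s hs => (H.deriv_v s (hx.trans hs.1)).mono (Ici_subset_Ici.2 (hx.trans hs.1)))
    (B := fun s => m + C * (s - x)) (B' := fun _ => C) (by simpa using hv)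
    (fun s => by simpa using (((hasDerivAt_id s).sub_const x).const_mul C).const_add m) ?_
    (right_mem_Icc.2 hxt)
  intro s hs hvs
  have h1 : 0 ≤ v s := by
    rw [hvs]
    have := mul_nonneg hC (sub_nonneg.2 hs.1)
    linarith
  have h2 := hD (h s) (ξ s) (H.pos s (hx.trans hs.1))
  have h3 : 0 ≤ μ * D (h s) (ξ s) * v s := by positivity
  linarith [hbC s ⟨hs.1, hs.2.le⟩]

/-- If the elastic force exceeds `β` on `[x, t]` while the height at time `x` is too small to allow
a descent lasting until time `t`, then the body no longer descends at time `t`. -/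
lemma velocity_nonneg (H : IsTrajectory a μ b D h₀ v₀ h ξ v u) (hμ : 0 < μ)
    (hD : ∀ x y : ℝ, 0 < x → 0 < D x y) {β x t : ℝ} (hx : 0 ≤ x) (hxt : x ≤ t) (hβ : 0 < β)
    (hbβ : ∀ s ∈ Icc x t, β < -b (ξ s)) (hh : h x ≤ β * (t - x) ^ 2 / 4) : 0 ≤ v t := by
  by_contra hneg
  push Not at hneg
  have key : ∀ y ∈ Icc x t, v y ≤ -β * (t - y) := by
    intro y hy
    by_contra hlt
    push Not at hlt
    have hy0 : 0 ≤ y := hx.trans hy.1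
    have := image_le_of_deriv_right_lt_deriv_boundary
      (f := fun s => - v s) (a := y) (b := t)
      (H.continuousOn_v.neg.mono fun s hs => hy0.trans hs.1)
      (fun s hs => ((H.deriv_v s (hy0.trans hs.1)).neg).mono (Ici_subset_Ici.2 (hy0.trans hs.1)))
      (B := fun s => β * (t - s)) (B' := fun _ => -β) (by linarith)
      (fun s => by simpa using (((hasDerivAt_id s).const_sub t).const_mul β)) ?_
      (right_mem_Icc.2 hy.2)
    · simp at this
      linarith
    · intro s hs hvs
      have h1 : v s ≤ 0 := by
        have := mul_nonneg hβ.le (sub_nonneg.2 hs.2.le)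
        linarith
      have h2 := hD (h s) (ξ s) (H.pos s (hy0.trans hs.1))
      have h3 : μ * D (h s) (ξ s) * v s ≤ 0 := mul_nonpos_of_nonneg_of_nonpos (by positivity) h1
      have := hbβ s ⟨hy.1.trans hs.1, hs.2.le⟩
      simp only [neg_sub, sub_neg_eq_add]
      linarith
  have h1 := le_add_of_hasDerivAt_le (f := h) (f' := v) (a := x) (b := (x + t) / 2)
    (C := -β * ((t - x) / 2)) (by linarith) (H.continuousOn_h.mono fun s hs => hx.trans hs.1)
    (fun s hs => hasDerivAt_of_hasDerivWithinAt_Ici (H.deriv_h s (hx.trans hs.1.le))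
      (hx.trans_lt hs.1))
    (fun s hs => (key s ⟨hs.1.le, by linarith [hs.2]⟩).trans (by
      have := mul_le_mul_of_nonneg_left (show (t - x) / 2 ≤ t - s by linarith [hs.2]) hβ.le
      linarith))
  have h2 := H.pos ((x + t) / 2) (by linarith)
  nlinarith

/-! ### Impulse of the drag -/

/-- Where the drag dominates `c₁ h ^ (-γ₁)`, its total impulse during descent is bounded, which
keeps `μ h ^ (1 - γ₁)` bounded. The quantity estimated below is the larger of `-v + f` and `f` with
`f = μ (c₁ / γ₁) h ^ (1 - γ₁)`: during descent the first one is the larger and the drag makes it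
grow at most like the elastic force, and during ascent `f` is the larger and does not increase. -/
lemma mul_rpow_le (H : IsTrajectory a μ b D h₀ v₀ h ξ v u) (hμ : 0 < μ)
    {δ₁ c₁ γ₁ C τ : ℝ} (hc₁ : 0 < c₁) (hγ₁ : 1 ≤ γ₁)
    (hD_mono : ∀ x : ℝ, 0 < x → ∀ ξ₁ ξ₂ : ℝ, ξ₁ ≤ ξ₂ → D x ξ₁ ≤ D x ξ₂)
    (hD_sing : ∀ x : ℝ, 0 < x → c₁ * x ^ (-γ₁) ≤ D x (-δ₁))
    (hτ : 0 ≤ τ) (hξ : ∀ s ∈ Icc 0 τ, -δ₁ ≤ ξ s) (hC : 0 ≤ C) (hbC : ∀ s ∈ Icc 0 τ, b (ξ s) ≤ C) :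
    μ * (c₁ / γ₁) * h τ ^ (1 - γ₁) ≤ |v₀| + μ * (c₁ / γ₁) * h₀ ^ (1 - γ₁) + C * τ := by
  have hγ0 : 0 < γ₁ := by linarith
  set κ := c₁ / γ₁ with hκ
  have hκ0 : 0 < κ := by positivity
  have hκγ : κ * (γ₁ - 1) ≤ c₁ := by
    rw [hκ, div_mul_eq_mul_div, div_le_iff₀ hγ0]; nlinarith
  set f : ℝ → ℝ := fun s => μ * κ * h s ^ (1 - γ₁) with hf
  set f' : ℝ → ℝ := fun s => -(μ * (κ * (γ₁ - 1)) * h s ^ (-γ₁) * v s) with hf'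
  have df : ∀ s, 0 ≤ s → HasDerivWithinAt f (f' s) (Ici 0) s := by
    intro s hs
    refine (((H.deriv_h s hs).rpow_const (p := 1 - γ₁)
      (Or.inl (H.pos s hs).ne')).const_mul (μ * κ)).congr_deriv ?_
    rw [hf', show 1 - γ₁ - 1 = -γ₁ by ring]
    ring
  have cf : ContinuousOn f (Icc 0 τ) := fun s hs =>
    ((df s hs.1).continuousWithinAt).mono Icc_subset_Ici_self
  have cv : ContinuousOn v (Icc 0 τ) := H.continuousOn_v.mono Icc_subset_Ici_self
  have key := max_le_add_of_deriv_le (f := fun s => -v s + f s) (g := f) (C := C) hτ (cv.neg.add cf)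
    cf (fun s hs => ((H.deriv_v s hs.1).neg.add (df s hs.1)).mono (Ici_subset_Ici.2 hs.1))
    (fun s hs => (df s hs.1).mono (Ici_subset_Ici.2 hs.1)) ?_ ?_
  · have h1 : max (-v 0 + f 0) (f 0) ≤ |v₀| + f 0 := by
      rw [H.v_zero]
      exact max_le (by linarith [neg_le_abs v₀]) (by linarith [abs_nonneg v₀])
    have h2 := (le_max_right (-v τ + f τ) (f τ)).trans key
    have h3 : f 0 = μ * κ * h₀ ^ (1 - γ₁) := by simp [hf, H.h_zero]
    rw [← h3]
    simp only [sub_zero] at h2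
    exact h2.trans (by linarith)
  · intro s hs hvs
    have hv : v s ≤ 0 := by simpa using hvs
    have h1 : κ * (γ₁ - 1) * h s ^ (-γ₁) ≤ D (h s) (ξ s) :=
      ((mul_le_mul_of_nonneg_right hκγ (Real.rpow_nonneg (H.pos s hs.1).le _)).trans
        (hD_sing _ (H.pos s hs.1))).trans (hD_mono _ (H.pos s hs.1) _ _ (hξ s ⟨hs.1, hs.2.le⟩))
    have h2 := mul_nonneg (mul_nonneg hμ.le (sub_nonneg.2 h1)) (neg_nonneg.2 hv)
    have h3 := hbC s ⟨hs.1, hs.2.le⟩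
    simp only [hf']
    nlinarith
  · intro s hs hvs
    have hv : 0 ≤ v s := by simpa using hvs
    have h1 := Real.rpow_nonneg (H.pos s hs.1).le (-γ₁)
    have h2 : 0 ≤ γ₁ - 1 := by linarith
    have : 0 ≤ μ * (κ * (γ₁ - 1)) * h s ^ (-γ₁) * v s := by positivity
    simp only [hf']
    linarith

/-- Once the body ascends and the drag is at most `γ(h) h ^ (-γ₁)`, the change of variables
`y = h(t)` turns the impulse of the drag into `∫ γ(y) / y dy` over small heights, so that the
elastic force `β` accelerates the body. -/
lemma le_velocity (H : IsTrajectory a μ b D h₀ v₀ h ξ v u) (hμ : 0 < μ)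
    {δ₂ γ₁ β A r ε t₁ t₂ : ℝ} {γ : ℝ → ℝ} (hγ₁ : 1 ≤ γ₁)
    (hD_mono : ∀ x : ℝ, 0 < x → ∀ ξ₁ ξ₂ : ℝ, ξ₁ ≤ ξ₂ → D x ξ₁ ≤ D x ξ₂)
    (hγ_nonneg : ∀ y : ℝ, 0 < y → 0 ≤ γ y)
    (hγ_int : IntegrableOn (fun y => γ y * y⁻¹) (Ioc 0 r))
    (hD_upper : ∀ x : ℝ, 0 < x → D x (-δ₂) ≤ γ x * x ^ (-γ₁))
    (h0 : 0 ≤ t₁) (h12 : t₁ ≤ t₂) (hv : ∀ s ∈ Icc t₁ t₂, 0 ≤ v s)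
    (hξ : ∀ s ∈ Icc t₁ t₂, ξ s ≤ -δ₂) (hbβ : ∀ s ∈ Icc t₁ t₂, β ≤ -b (ξ s))
    (hA : μ * h t₁ ^ (1 - γ₁) ≤ A) (hr : h t₂ ≤ r)
    (hε : ∫ y in (0 : ℝ)..h t₂, γ y * y⁻¹ ≤ ε) :
    β * (t₂ - t₁) - A * ε ≤ v t₂ := by
  have hpos : ∀ s ∈ Icc t₁ t₂, 0 < h s := fun s hs => H.pos s (h0.trans hs.1)
  have hcont : ContinuousOn h (Icc t₁ t₂) := H.continuousOn_h.mono fun s hs => h0.trans hs.1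
  have hder : ∀ s ∈ Ioo t₁ t₂, HasDerivAt h (v s) s := fun s hs =>
    hasDerivAt_of_hasDerivWithinAt_Ici (H.deriv_h s (h0.trans hs.1.le)) (h0.trans_lt hs.1)
  have hv' : ∀ s ∈ Ioo t₁ t₂, 0 ≤ v s := fun s hs => hv s ⟨hs.1.le, hs.2.le⟩
  have hmono : ∀ s ∈ Icc t₁ t₂, h t₁ ≤ h s := by
    intro s hs
    simpa using add_le_of_le_hasDerivAt (C := 0) hs.1 (hcont.mono (Icc_subset_Icc_right hs.2))
      (fun y hy => hder y ⟨hy.1, hy.2.trans_le hs.2⟩)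
      (fun y hy => hv' y ⟨hy.1, hy.2.trans_le hs.2⟩)
  have hp1 := hpos t₁ (left_mem_Icc.2 h12)
  have hp2 := hpos t₂ (right_mem_Icc.2 h12)
  have hm := hmono t₂ (right_mem_Icc.2 h12)
  have hA0 : 0 ≤ A := le_trans (by positivity) hA
  set g : ℝ → ℝ := fun y => γ y * y⁻¹ with hg
  have gint : IntegrableOn g (Icc (h t₁) (h t₂)) :=
    hγ_int.mono_set fun y hy => ⟨hp1.trans_le hy.1, hy.2.trans hr⟩
  have gcomp : IntegrableOn (fun s => v s * g (h s)) (Icc t₁ t₂) := by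
    simpa using (integrableOn_Icc_deriv_smul_iff_of_deriv_nonneg (g := g) hcont hder hv' h12).2 gint
  have gval : ∫ s in t₁..t₂, v s * g (h s) ≤ ε := by
    have h1 := integral_Icc_deriv_smul_of_deriv_nonneg (g := g) hcont hder hv' h12
    rw [intervalIntegral.integral_of_le h12, ← integral_Icc_eq_integral_Ioc]
    simp only [smul_eq_mul] at h1
    rw [h1]
    refine le_trans ?_ hε
    rw [intervalIntegral.integral_of_le hp2.le]
    refine setIntegral_mono_set (hγ_int.mono_set (Ioc_subset_Ioc_right hr)) ?_
      (LE.le.eventuallyLE fun y hy => ⟨hp1.trans_le hy.1, hy.2⟩)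
    filter_upwards [ae_restrict_mem measurableSet_Ioc] with y hy
    exact mul_nonneg (hγ_nonneg y hy.1) (inv_nonneg.2 hy.1.le)
  have hv1 := hv t₁ (left_mem_Icc.2 h12)
  have key := intervalIntegral.integral_le_sub_of_hasDeriv_right_of_le (g := v)
    (φ := fun s => β - A * (v s * g (h s))) h12 (H.continuousOn_v.mono fun s hs => h0.trans hs.1)
    (fun s hs => (H.deriv_v s (h0.trans hs.1.le)).mono fun y hy =>
      (h0.trans hs.1.le).trans (le_of_lt hy))
    ((integrableOn_const (by simp)).sub (gcomp.const_mul A)) ?_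
  · rw [intervalIntegral.integral_sub (by simp), intervalIntegral.integral_const,
      intervalIntegral.integral_const_mul, smul_eq_mul] at key
    · nlinarith [mul_le_mul_of_nonneg_left gval hA0]
    · exact ((intervalIntegrable_iff_integrableOn_Icc_of_le h12).2 gcomp).const_mul A
  · intro s hs
    have hs' : s ∈ Icc t₁ t₂ := ⟨hs.1.le, hs.2.le⟩
    have hps := hpos s hs'
    have h1 : D (h s) (ξ s) ≤ γ (h s) * h s ^ (-γ₁) :=
      (hD_mono _ hps _ _ (hξ s hs')).trans (hD_upper _ hps)
    have h2 : μ * h s ^ (1 - γ₁) ≤ A :=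
      (mul_le_mul_of_nonneg_left (Real.rpow_le_rpow_of_nonpos hp1 (hmono s hs') (by linarith))
        hμ.le).trans hA
    have h3 : h s ^ (-γ₁) = h s ^ (1 - γ₁) * (h s)⁻¹ := by
      rw [← Real.rpow_neg_one, ← Real.rpow_add hps]; ring_nf
    have h4 : 0 ≤ g (h s) := mul_nonneg (hγ_nonneg _ hps) (inv_nonneg.2 hps.le)
    have h5 : μ * D (h s) (ξ s) ≤ A * g (h s) := by
      calc μ * D (h s) (ξ s) ≤ μ * (γ (h s) * h s ^ (-γ₁)) := mul_le_mul_of_nonneg_left h1 hμ.le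
        _ = (μ * h s ^ (1 - γ₁)) * g (h s) := by rw [h3, hg]; ring
        _ ≤ A * g (h s) := mul_le_mul_of_nonneg_right h2 h4
    have h6 := mul_le_mul_of_nonneg_right h5 (hv s hs')
    have h7 := hbβ s hs'
    linarith

end IsTrajectory

/-! ### Limits of equi-Lipschitz families -/

lemma abs_sub_le_of_hasDerivWithinAt {f f' : ℝ → ℝ} {L : ℝ}
    (hf : ∀ t, 0 ≤ t → HasDerivWithinAt f (f' t) (Ici 0) t) (hL : ∀ t, 0 ≤ t → |f' t| ≤ L)
    {s t : ℝ} (hs : 0 ≤ s) (ht : 0 ≤ t) : |f t - f s| ≤ L * |t - s| :=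
  (convex_Ici (0 : ℝ)).norm_image_sub_le_of_norm_hasDerivWithin_le (f := f) (f' := f') hf hL hs ht

section limits

variable {l : Filter ℕ} [l.NeBot] {f g : ℕ → ℝ → ℝ} {F G : ℝ → ℝ} {L : ℝ}

lemma abs_sub_le_of_tendsto
    (hf : ∀ n s t, 0 ≤ s → 0 ≤ t → |f n t - f n s| ≤ L * |t - s|)
    (hF : ∀ t, 0 ≤ t → Tendsto (fun n => f n t) l (𝓝 (F t))) {s t : ℝ} (hs : 0 ≤ s) (ht : 0 ≤ t) :
    |F t - F s| ≤ L * |t - s| :=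
  le_of_tendsto ((hF t ht).sub (hF s hs)).abs (Eventually.of_forall fun n => hf n s t hs ht)

lemma continuousOn_of_abs_sub_le
    (hF : ∀ s t, 0 ≤ s → 0 ≤ t → |F t - F s| ≤ L * |t - s|) : ContinuousOn F (Ici 0) := by
  refine LipschitzOnWith.continuousOn (K := L.toNNReal) (LipschitzOnWith.of_dist_le_mul ?_)
  intro x hx y hy
  rw [Real.dist_eq, Real.dist_eq]
  exact (hF y x hy hx).trans (mul_le_mul_of_nonneg_right (Real.le_coe_toNNReal L) (abs_nonneg _))

/-- Pointwise convergence of an equi-Lipschitz family along any filter is uniform on compact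
intervals. -/
lemma eventually_forall_abs_sub_lt
    (hf : ∀ n s t, 0 ≤ s → 0 ≤ t → |f n t - f n s| ≤ L * |t - s|)
    (hF : ∀ t, 0 ≤ t → Tendsto (fun n => f n t) l (𝓝 (F t))) {p q ε : ℝ} (hp : 0 ≤ p)
    (hε : 0 < ε) : ∀ᶠ n in l, ∀ t ∈ Icc p q, |f n t - F t| < ε := by
  have hFL : ∀ s t, 0 ≤ s → 0 ≤ t → |F t - F s| ≤ L * |t - s| :=
    fun s t hs ht => abs_sub_le_of_tendsto hf hF hs ht
  set e := ε / (4 * (|L| + 1)) with he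
  have he0 : 0 < e := by positivity
  have hLe : ∀ x, |x| < e → L * |x| ≤ ε / 4 := by
    intro x hx
    calc L * |x| ≤ (|L| + 1) * e :=
          mul_le_mul (by linarith [le_abs_self L]) hx.le (abs_nonneg _) (by positivity)
      _ = ε / 4 := by rw [he]; field_simp
  obtain ⟨A, hA, hfin, hcov⟩ := (isCompact_Icc (a := p) (b := q)).finite_cover_balls he0
  have h1 : ∀ᶠ n in l, ∀ x ∈ A, |f n x - F x| < ε / 4 := by
    rw [eventually_all_finite hfin]
    intro x hx
    have := (hF x (hp.trans (hA hx).1)).eventually (Metric.ball_mem_nhds _ (by positivity : 0 < ε / 4))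
    simpa [Real.dist_eq] using this
  filter_upwards [h1] with n hn t ht
  obtain ⟨x, hx, htx⟩ := mem_iUnion₂.1 (hcov ht)
  rw [Metric.mem_ball, Real.dist_eq] at htx
  have hx0 := hp.trans (hA hx).1
  have ht0 := hp.trans ht.1
  have a1 := (hf n x t hx0 ht0).trans (hLe _ htx)
  have a2 := (hFL x t hx0 ht0).trans (hLe _ htx)
  have a3 := hn x hx
  rw [abs_le] at a1 a2
  rw [abs_lt] at a3 ⊢
  constructor <;> linarith [a1.1, a1.2, a2.1, a2.2, a3.1, a3.2]

/-- Derivatives pass to pointwise limits when they are equi-Lipschitz, because the first-order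
Taylor remainder is then bounded by `L (t - s) ^ 2` uniformly in the family. -/
lemma hasDerivWithinAt_of_tendsto
    (hf : ∀ n t, 0 ≤ t → HasDerivWithinAt (f n) (g n t) (Ici 0) t)
    (hg : ∀ n s t, 0 ≤ s → 0 ≤ t → |g n t - g n s| ≤ L * |t - s|)
    (hF : ∀ t, 0 ≤ t → Tendsto (fun n => f n t) l (𝓝 (F t)))
    (hG : ∀ t, 0 ≤ t → Tendsto (fun n => g n t) l (𝓝 (G t))) {t : ℝ} (ht : 0 ≤ t) :
    HasDerivWithinAt F (G t) (Ici 0) t := by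
  have hL : 0 ≤ L := by simpa using (abs_nonneg _).trans (hg 0 0 1 le_rfl zero_le_one)
  have taylor : ∀ n s, 0 ≤ s → |f n s - f n t - g n t * (s - t)| ≤ L * |s - t| * |s - t| := by
    intro n s hs
    have h1 : ∀ y ∈ Ici (0 : ℝ) ∩ uIcc t s,
        HasDerivWithinAt (fun y => f n y - g n t * y) (g n y - g n t) (Ici 0 ∩ uIcc t s) y := by
      intro y hy
      have := ((hf n y hy.1).mono (inter_subset_left (t := uIcc t s))).sub
        (((hasDerivAt_id y).const_mul (g n t)).hasDerivWithinAt)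
      exact this.congr_deriv (by simp)
    have h2 : ∀ y ∈ Ici (0 : ℝ) ∩ uIcc t s, ‖g n y - g n t‖ ≤ L * |s - t| := by
      intro y hy
      refine (hg n t y ht hy.1).trans (mul_le_mul_of_nonneg_left ?_ hL)
      exact abs_sub_left_of_mem_uIcc hy.2
    have h3 := ((convex_Ici (0 : ℝ)).inter (convex_uIcc t s)).norm_image_sub_le_of_norm_hasDerivWithin_le
      h1 h2 ⟨ht, left_mem_uIcc⟩ ⟨hs, right_mem_uIcc⟩
    rw [Real.norm_eq_abs, Real.norm_eq_abs] at h3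
    convert h3 using 2
    ring
  have taylor' : ∀ s, 0 ≤ s → |F s - F t - G t * (s - t)| ≤ L * |s - t| * |s - t| := fun s hs =>
    le_of_tendsto ((((hF s hs).sub (hF t ht)).sub ((hG t ht).mul_const _)).abs)
      (Eventually.of_forall fun n => taylor n s hs)
  rw [hasDerivWithinAt_iff_isLittleO, Asymptotics.isLittleO_iff]
  intro c hc
  have : ∀ᶠ s in 𝓝[Ici 0] t, |s - t| < c / (L + 1) := by
    apply eventually_nhdsWithin_of_eventually_nhds
    have := Metric.ball_mem_nhds t (show 0 < c / (L + 1) by positivity)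
    filter_upwards [this] with s hs
    simpa [Real.dist_eq] using hs
  filter_upwards [this, self_mem_nhdsWithin] with s hs hs0
  rw [lt_div_iff₀ (by positivity)] at hs
  rw [Real.norm_eq_abs, Real.norm_eq_abs, smul_eq_mul, mul_comm (s - t)]
  refine (taylor' s hs0).trans (mul_le_mul_of_nonneg_right ?_ (abs_nonneg _))
  nlinarith [abs_nonneg (s - t)]

end limits

lemma exists_tendsto_of_abs_le (U : Ultrafilter ℕ) {f : ℕ → ℝ → ℝ} {M : ℝ → ℝ}
    (hf : ∀ n t, 0 ≤ t → |f n t| ≤ M t) :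
    ∃ F : ℝ → ℝ, ∀ t, 0 ≤ t → Tendsto (fun n => f n t) U (𝓝 (F t)) := by
  have : ∀ t, ∃ y, 0 ≤ t → Tendsto (fun n => f n t) U (𝓝 y) := by
    intro t
    by_cases ht : 0 ≤ t
    · obtain ⟨y, -, hy⟩ := (isCompact_Icc (a := -M t) (b := M t)).ultrafilter_le_nhds
        (U.map fun n => f n t) (by
          rw [le_principal_iff]
          exact Filter.mem_map.2 (univ_mem' fun n => abs_le.1 (hf n t ht)))
      exact ⟨y, fun _ => hy⟩
    · exact ⟨0, fun h => absurd h ht⟩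
  choose F hF using this
  exact ⟨F, hF⟩

/-! ### First and last zeros -/

lemma exists_first_zero {f : ℝ → ℝ} {p q : ℝ} (hpq : p ≤ q) (hf : ContinuousOn f (Icc p q))
    (hp : 0 < f p) (hq : f q ≤ 0) : ∃ r ∈ Ioc p q, f r = 0 ∧ ∀ x ∈ Ico p r, 0 < f x := by
  set A := {x ∈ Icc p q | f x ≤ 0} with hA
  have hAne : A.Nonempty := ⟨q, right_mem_Icc.2 hpq, hq⟩
  have hAc : IsCompact A := by
    have : IsClosed A := hf.preimage_isClosed_of_isClosed isClosed_Icc isClosed_Iic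
    exact isCompact_Icc.of_isClosed_subset this fun x hx => hx.1
  obtain ⟨r, hr, hmin⟩ := hAc.exists_isLeast hAne
  have hpos : ∀ x ∈ Ico p r, 0 < f x := by
    intro x hx
    by_contra h
    exact absurd (hmin ⟨⟨hx.1, hx.2.le.trans hr.1.2⟩, not_lt.1 h⟩) (not_le.2 hx.2)
  have hpr : p < r := lt_of_le_of_ne hr.1.1 (by rintro rfl; exact absurd hr.2 (not_le.2 hp))
  refine ⟨r, ⟨hpr, hr.1.2⟩, le_antisymm hr.2 ?_, hpos⟩
  have hc : Tendsto f (𝓝[Ico p r] r) (𝓝 (f r)) :=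
    (hf r hr.1).mono fun x hx => ⟨hx.1, hx.2.le.trans hr.1.2⟩
  have : (𝓝[Ico p r] r).NeBot := by
    rw [nhdsWithin_Ico_eq_nhdsLT hpr]; infer_instance
  exact ge_of_tendsto hc (eventually_nhdsWithin_of_forall fun x hx => (hpos x hx).le)

lemma exists_last_zero {f : ℝ → ℝ} {p q : ℝ} (hpq : p ≤ q) (hf : ContinuousOn f (Icc p q))
    (hp : f p ≤ 0) (hq : 0 < f q) : ∃ s ∈ Ico p q, f s = 0 ∧ ∀ x ∈ Ioc s q, 0 < f x := by
  obtain ⟨r, hr, hr0, hr1⟩ := exists_first_zero (f := fun x => f (-x)) (neg_le_neg hpq)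
    (hf.comp continuous_neg.continuousOn fun x hx => ⟨by linarith [hx.2], by linarith [hx.1]⟩)
    (by simpa using hq) (by simpa using hp)
  refine ⟨-r, ⟨by linarith [hr.2], by linarith [hr.1]⟩, hr0, fun x hx => ?_⟩
  simpa using hr1 (-x) ⟨by linarith [hx.2], by linarith [hx.1]⟩

lemma exists_pos_forall_le {f : ℝ → ℝ} {p q : ℝ} (hpq : p ≤ q) (hf : ContinuousOn f (Icc p q))
    (hpos : ∀ x ∈ Icc p q, 0 < f x) : ∃ m, 0 < m ∧ ∀ x ∈ Icc p q, m ≤ f x := by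
  obtain ⟨x, hx, hmin⟩ := isCompact_Icc.exists_isMinOn (nonempty_Icc.2 hpq) hf
  exact ⟨f x, hpos x hx, fun y hy => hmin hy⟩

lemma eq_zero_of_forall_Ico {f : ℝ → ℝ} {p r : ℝ} (hpr : p < r) (hf : ContinuousOn f (Icc p r))
    (h0 : ∀ x ∈ Ico p r, f x = 0) : f r = 0 := by
  have hc : Tendsto f (𝓝[Ico p r] r) (𝓝 (f r)) :=
    (hf r (right_mem_Icc.2 hpr.le)).mono Ico_subset_Icc_self
  have : (𝓝[Ico p r] r).NeBot := by
    rw [nhdsWithin_Ico_eq_nhdsLT hpr]; infer_instance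
  exact tendsto_nhds_unique hc (tendsto_const_nhds.congr'
    (eventually_nhdsWithin_of_forall fun x hx => (h0 x hx).symm))

lemma exists_pos_right {f : ℝ → ℝ} {s : ℝ} (hs : 0 ≤ s) (hf : ContinuousOn f (Ici 0))
    (hpos : 0 < f s) : ∃ ε, 0 < ε ∧ ∀ y ∈ Icc s (s + ε), 0 < f y := by
  have h1 := (hf s hs).eventually (lt_mem_nhds hpos)
  rw [eventually_nhdsWithin_iff, Metric.eventually_nhds_iff] at h1
  obtain ⟨ε, hε, h2⟩ := h1
  refine ⟨ε / 2, half_pos hε, fun y hy => h2 ?_ (hs.trans hy.1)⟩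
  rw [Real.dist_eq, abs_of_nonneg (sub_nonneg.2 hy.1)]
  linarith [hy.2]

/-! ### Vanishing-viscosity limits -/

/-- The functions `h`, `ξ`, `u` are the pointwise limits, along an ultrafilter on the index set, of
trajectories `(hn n, ξn n, vn n, un n)` with viscosities `μ n → 0` that satisfy uniform bounds
`V` on the velocities, `X` on the deformation and `C` on the elastic force. The velocities `vn n`
of the body are not equicontinuous and need not converge, so no limit is attached to them. -/
structure IsVanishingLimit (a : ℝ) (b : ℝ → ℝ) (D : ℝ → ℝ → ℝ) (h₀ v₀ V X C : ℝ)
    (U : Ultrafilter ℕ) (μ : ℕ → ℝ) (hn ξn vn un : ℕ → ℝ → ℝ) (h ξ u : ℝ → ℝ) : Prop where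
  a_pos : 0 < a
  V_pos : 0 < V
  C_pos : 0 < C
  μ_pos : ∀ n, 0 < μ n
  μ_tendsto : Tendsto μ U (𝓝 0)
  traj : ∀ n, IsTrajectory a (μ n) b D h₀ v₀ (hn n) (ξn n) (vn n) (un n)
  v_le : ∀ n t, 0 ≤ t → |vn n t| ≤ V
  u_le : ∀ n t, 0 ≤ t → |un n t| ≤ V
  ξ_le : ∀ n t, 0 ≤ t → |ξn n t| ≤ X
  b_le : ∀ x, |x| ≤ X → |b x| ≤ C
  b_lip : LocallyLipschitz b
  b_sign : ∀ y : ℝ, y ≠ 0 → 0 < b y * y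
  D_pos : ∀ x y : ℝ, 0 < x → 0 < D x y
  D_cont : ContinuousOn (fun p : ℝ × ℝ => D p.1 p.2) (Ioi (0 : ℝ) ×ˢ (univ : Set ℝ))
  tendsto_h : ∀ t, 0 ≤ t → Tendsto (fun n => hn n t) U (𝓝 (h t))
  tendsto_ξ : ∀ t, 0 ≤ t → Tendsto (fun n => ξn n t) U (𝓝 (ξ t))
  tendsto_u : ∀ t, 0 ≤ t → Tendsto (fun n => un n t) U (𝓝 (u t))

namespace IsVanishingLimit

variable {a : ℝ} {b : ℝ → ℝ} {D : ℝ → ℝ → ℝ} {h₀ v₀ V X C : ℝ}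
  {U : Ultrafilter ℕ} {μ : ℕ → ℝ} {hn ξn vn un : ℕ → ℝ → ℝ} {h ξ u : ℝ → ℝ}

lemma b_cont (H : IsVanishingLimit a b D h₀ v₀ V X C U μ hn ξn vn un h ξ u) : Continuous b :=
  H.b_lip.continuous

lemma lip_hn (H : IsVanishingLimit a b D h₀ v₀ V X C U μ hn ξn vn un h ξ u) (n : ℕ) (s t : ℝ)
    (hs : 0 ≤ s) (ht : 0 ≤ t) : |hn n t - hn n s| ≤ V * |t - s| :=
  abs_sub_le_of_hasDerivWithinAt (H.traj n).deriv_h (H.v_le n) hs ht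

lemma lip_ξn (H : IsVanishingLimit a b D h₀ v₀ V X C U μ hn ξn vn un h ξ u) (n : ℕ) (s t : ℝ)
    (hs : 0 ≤ s) (ht : 0 ≤ t) : |ξn n t - ξn n s| ≤ (V + V) * |t - s| :=
  abs_sub_le_of_hasDerivWithinAt (H.traj n).deriv_ξ
    (fun t ht => (abs_sub _ _).trans (add_le_add (H.v_le n t ht) (H.u_le n t ht))) hs ht

lemma lip_un (H : IsVanishingLimit a b D h₀ v₀ V X C U μ hn ξn vn un h ξ u) (n : ℕ) (s t : ℝ)
    (hs : 0 ≤ s) (ht : 0 ≤ t) : |un n t - un n s| ≤ (a * C) * |t - s| :=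
  abs_sub_le_of_hasDerivWithinAt (H.traj n).deriv_u
    (fun t ht => by
      rw [abs_mul, abs_of_pos H.a_pos]
      exact mul_le_mul_of_nonneg_left (H.b_le _ (H.ξ_le n t ht)) H.a_pos.le) hs ht

lemma lip_u (H : IsVanishingLimit a b D h₀ v₀ V X C U μ hn ξn vn un h ξ u) {s t : ℝ}
    (hs : 0 ≤ s) (ht : 0 ≤ t) : |u t - u s| ≤ (a * C) * |t - s| :=
  abs_sub_le_of_tendsto H.lip_un H.tendsto_u hs ht

lemma lip_ξ (H : IsVanishingLimit a b D h₀ v₀ V X C U μ hn ξn vn un h ξ u) {s t : ℝ}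
    (hs : 0 ≤ s) (ht : 0 ≤ t) : |ξ t - ξ s| ≤ (V + V) * |t - s| :=
  abs_sub_le_of_tendsto H.lip_ξn H.tendsto_ξ hs ht

lemma continuousOn_h (H : IsVanishingLimit a b D h₀ v₀ V X C U μ hn ξn vn un h ξ u) :
    ContinuousOn h (Ici 0) :=
  continuousOn_of_abs_sub_le fun _ _ hs ht => abs_sub_le_of_tendsto H.lip_hn H.tendsto_h hs ht

lemma continuousOn_ξ (H : IsVanishingLimit a b D h₀ v₀ V X C U μ hn ξn vn un h ξ u) :
    ContinuousOn ξ (Ici 0) :=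
  continuousOn_of_abs_sub_le fun _ _ hs ht => abs_sub_le_of_tendsto H.lip_ξn H.tendsto_ξ hs ht

lemma continuousOn_u (H : IsVanishingLimit a b D h₀ v₀ V X C U μ hn ξn vn un h ξ u) :
    ContinuousOn u (Ici 0) :=
  continuousOn_of_abs_sub_le fun _ _ hs ht => H.lip_u hs ht

lemma h_nonneg (H : IsVanishingLimit a b D h₀ v₀ V X C U μ hn ξn vn un h ξ u) {t : ℝ}
    (ht : 0 ≤ t) : 0 ≤ h t :=
  ge_of_tendsto (H.tendsto_h t ht) (Eventually.of_forall fun n => ((H.traj n).pos t ht).le)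

lemma h_zero (H : IsVanishingLimit a b D h₀ v₀ V X C U μ hn ξn vn un h ξ u) : h 0 = h₀ :=
  tendsto_nhds_unique (H.tendsto_h 0 le_rfl) (by simp [(H.traj _).h_zero])

lemma ξ_zero (H : IsVanishingLimit a b D h₀ v₀ V X C U μ hn ξn vn un h ξ u) : ξ 0 = 0 :=
  tendsto_nhds_unique (H.tendsto_ξ 0 le_rfl) (by simp [(H.traj _).ξ_zero])

lemma u_zero (H : IsVanishingLimit a b D h₀ v₀ V X C U μ hn ξn vn un h ξ u) : u 0 = v₀ :=
  tendsto_nhds_unique (H.tendsto_u 0 le_rfl) (by simp [(H.traj _).u_zero])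

lemma hasDerivAt_sub (H : IsVanishingLimit a b D h₀ v₀ V X C U μ hn ξn vn un h ξ u) {t : ℝ}
    (ht : 0 < t) : HasDerivAt (fun s => h s - ξ s) (u t) t :=
  hasDerivAt_of_hasDerivWithinAt_Ici (hasDerivWithinAt_of_tendsto
    (f := fun n s => hn n s - ξn n s) (fun n s hs =>
      (((H.traj n).deriv_h s hs).sub ((H.traj n).deriv_ξ s hs)).congr_deriv (by ring))
    H.lip_un (fun s hs => (H.tendsto_h s hs).sub (H.tendsto_ξ s hs)) H.tendsto_u ht.le) ht

lemma hasDerivAt_u (H : IsVanishingLimit a b D h₀ v₀ V X C U μ hn ξn vn un h ξ u) {t : ℝ}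
    (ht : 0 < t) : HasDerivAt u (a * b (ξ t)) t := by
  obtain ⟨K, hK⟩ := (H.b_lip.locallyLipschitzOn (s := Icc (-X) X)).exists_lipschitzOnWith_of_compact
    isCompact_Icc
  refine hasDerivAt_of_hasDerivWithinAt_Ici (hasDerivWithinAt_of_tendsto
    (fun n s hs => (H.traj n).deriv_u s hs) (L := a * (K * (V + V))) (fun n s t hs ht => ?_)
    H.tendsto_u (fun s hs => ((H.b_cont.tendsto _).comp (H.tendsto_ξ s hs)).const_mul a) ht.le) ht
  rw [← mul_sub, abs_mul, abs_of_pos H.a_pos, mul_assoc]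
  refine mul_le_mul_of_nonneg_left ?_ H.a_pos.le
  have h1 := hK.dist_le_mul _ (abs_le.1 (H.ξ_le n t ht)) _ (abs_le.1 (H.ξ_le n s hs))
  rw [Real.dist_eq, Real.dist_eq] at h1
  refine h1.trans ?_
  rw [mul_assoc]
  exact mul_le_mul_of_nonneg_left (H.lip_ξn n s t hs ht) K.2

/-! ### Free motion away from the wall -/

/-- While the limit stays away from the wall the drag is `O(μ)`, so the momentum `a v + u` is
asymptotically conserved. -/
lemma eventually_momentum (H : IsVanishingLimit a b D h₀ v₀ V X C U μ hn ξn vn un h ξ u)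
    {p q ε : ℝ} (hp : 0 ≤ p) (hpq : p ≤ q) (hpos : ∀ t ∈ Icc p q, 0 < h t) (hε : 0 < ε) :
    ∀ᶠ n in U, ∀ t ∈ Icc p q,
      |(a * vn n t + un n t) - (a * vn n p + un n p)| ≤ ε := by
  have ha := H.a_pos
  have hV := H.V_pos
  obtain ⟨m, hm, hm'⟩ := exists_pos_forall_le hpq
    (H.continuousOn_h.mono fun t ht => hp.trans ht.1) hpos
  obtain ⟨M, hM⟩ := ((isCompact_Icc (a := m / 2) (b := h₀ + V * q)).prod
    (isCompact_Icc (a := -X) (b := X))).exists_bound_of_continuousOn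
      (H.D_cont.mono fun x hx => ⟨(half_pos hm).trans_le hx.1.1, mem_univ _⟩)
  have hsmall : ∀ᶠ n in U, a * μ n * (max M 0 * V) * (q - p) < ε := by
    have : Tendsto (fun n => a * μ n * (max M 0 * V) * (q - p)) U (𝓝 0) := by
      simpa using (((H.μ_tendsto.const_mul a).mul_const (max M 0 * V)).mul_const (q - p))
    exact this.eventually_lt_const hε
  filter_upwards [hsmall, eventually_forall_abs_sub_lt H.lip_hn H.tendsto_h (q := q) hp
    (half_pos hm)] with n h1 h2 t ht
  have hμ := H.μ_pos n
  have bound : ∀ s ∈ Icc p q, |-(a * μ n * (D (hn n s) (ξn n s) * vn n s))| ≤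
      a * μ n * (max M 0 * V) := by
    intro s hs
    have hs0 := hp.trans hs.1
    have h3 := abs_lt.1 (h2 s hs)
    have h4 := abs_le.1 (H.lip_hn n 0 s le_rfl hs0)
    rw [(H.traj n).h_zero, sub_zero, abs_of_nonneg hs0] at h4
    have h5 : V * s ≤ V * q := mul_le_mul_of_nonneg_left hs.2 hV.le
    have h6 : |D (hn n s) (ξn n s)| ≤ M := hM (hn n s, ξn n s)
      ⟨⟨by linarith [hm' s hs], by linarith⟩, abs_le.1 (H.ξ_le n s hs0)⟩
    rw [abs_neg, abs_mul (a * μ n), abs_of_pos (mul_pos ha hμ), abs_mul]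
    exact mul_le_mul_of_nonneg_left (mul_le_mul (h6.trans (le_max_left _ _)) (H.v_le n s hs0)
      (abs_nonneg _) (le_max_right _ _)) (mul_pos ha hμ).le
  have h7 := (convex_Icc p q).norm_image_sub_le_of_norm_hasDerivWithin_le
    (f := fun s => a * vn n s + un n s) (fun s hs =>
      (((((H.traj n).deriv_v s (hp.trans hs.1)).const_mul a).add
        ((H.traj n).deriv_u s (hp.trans hs.1))).congr_deriv (show _ =
          -(a * μ n * (D (hn n s) (ξn n s) * vn n s)) by ring)).mono fun y hy => hp.trans hy.1)
    bound (left_mem_Icc.2 hpq) ht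
  rw [Real.norm_eq_abs, Real.norm_eq_abs, abs_of_nonneg (sub_nonneg.2 ht.1)] at h7
  refine h7.trans (le_trans ?_ h1.le)
  exact mul_le_mul_of_nonneg_left (by linarith [ht.2]) ((abs_nonneg _).trans (bound t ht))

lemma momentum_const (H : IsVanishingLimit a b D h₀ v₀ V X C U μ hn ξn vn un h ξ u)
    {p q P : ℝ} (hp : 0 ≤ p) (hpq : p ≤ q) (hpos : ∀ t ∈ Icc p q, 0 < h t)
    (hP : Tendsto (fun n => a * vn n p + un n p) U (𝓝 P)) :
    Tendsto (fun n => a * vn n q + un n q) U (𝓝 P) ∧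
      ((1 + a) * h q - ξ q) - ((1 + a) * h p - ξ p) = P * (q - p) := by
  constructor
  · have h1 : Tendsto (fun n => (a * vn n q + un n q) - (a * vn n p + un n p)) U (𝓝 0) := by
      rw [Metric.tendsto_nhds]
      intro ε hε
      filter_upwards [H.eventually_momentum hp hpq hpos (half_pos hε)] with n h2
      rw [Real.dist_eq, sub_zero]
      exact (h2 q (right_mem_Icc.2 hpq)).trans_lt (half_lt_self hε)
    simpa using h1.add hP
  · have hq := hp.trans hpq
    have h1 : ∀ ε > 0, |((1 + a) * h q - ξ q) - ((1 + a) * h p - ξ p) - P * (q - p)| ≤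
        ε * (q - p) := by
      intro ε hε
      refine le_of_tendsto ((((((H.tendsto_h q hq).const_mul (1 + a)).sub (H.tendsto_ξ q hq)).sub
        (((H.tendsto_h p hp).const_mul (1 + a)).sub (H.tendsto_ξ p hp))).sub
          (hP.mul_const (q - p))).abs) ?_
      filter_upwards [H.eventually_momentum hp hpq hpos hε] with n h2
      have hd : ∀ s ∈ Icc p q, HasDerivWithinAt
          (fun s => (1 + a) * hn n s - ξn n s - (a * vn n p + un n p) * s)
          ((a * vn n s + un n s) - (a * vn n p + un n p)) (Icc p q) s := fun s hs =>
        ((((((H.traj n).deriv_h s (hp.trans hs.1)).const_mul (1 + a)).sub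
          ((H.traj n).deriv_ξ s (hp.trans hs.1))).sub
            ((hasDerivAt_id s).const_mul (a * vn n p + un n p)).hasDerivWithinAt).congr_deriv
              (by ring)).mono fun y hy => hp.trans hy.1
      have h3 := (convex_Icc p q).norm_image_sub_le_of_norm_hasDerivWithin_le hd h2
        (left_mem_Icc.2 hpq) (right_mem_Icc.2 hpq)
      rw [Real.norm_eq_abs, Real.norm_eq_abs, abs_of_nonneg (sub_nonneg.2 hpq)] at h3
      refine (le_of_eq (congrArg abs ?_)).trans h3
      ring
    have h2 : |((1 + a) * h q - ξ q) - ((1 + a) * h p - ξ p) - P * (q - p)| ≤ 0 := by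
      rcases hpq.eq_or_lt with rfl | hlt
      · simp
      · refine le_of_forall_pos_le_add fun e he => ?_
        have := h1 (e / (q - p)) (div_pos he (sub_pos.2 hlt))
        rwa [div_mul_cancel₀ _ (sub_pos.2 hlt).ne', ← zero_add e] at this
    linarith [abs_nonpos_iff.1 h2]

lemma exists_momentum (H : IsVanishingLimit a b D h₀ v₀ V X C U μ hn ξn vn un h ξ u)
    {t : ℝ} (ht : 0 ≤ t) : ∃ P, Tendsto (fun n => a * vn n t + un n t) U (𝓝 P) := by
  obtain ⟨F, hF⟩ := exists_tendsto_of_abs_le U (f := vn) (M := fun _ => V) H.v_le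
  exact ⟨_, ((hF t ht).const_mul a).add (H.tendsto_u t ht)⟩

/-- Free motion before an excursion reaches the wall again: the momentum tends to a constant `P`,
and `h` moves with velocity `(P - u) / a`. -/
lemma exists_momentum_Ioo (H : IsVanishingLimit a b D h₀ v₀ V X C U μ hn ξn vn un h ξ u)
    {s r : ℝ} (hs : 0 ≤ s) (hsr : s < r) (hpos : ∀ t ∈ Ioo s r, 0 < h t) :
    ∃ P, ∀ t ∈ Ioo s r, Tendsto (fun n => a * vn n t + un n t) U (𝓝 P) ∧
      HasDerivAt h ((P - u t) / a) t := by
  have ha := H.a_pos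
  obtain ⟨P, hP⟩ := H.exists_momentum (t := (s + r) / 2) (by linarith)
  have hmid : (s + r) / 2 ∈ Ioo s r := ⟨by linarith, by linarith⟩
  have conv : ∀ t ∈ Ioo s r, Tendsto (fun n => a * vn n t + un n t) U (𝓝 P) := by
    intro t ht
    rcases le_total ((s + r) / 2) t with h1 | h1
    · exact (H.momentum_const (hs.trans hmid.1.le) h1
        (fun y hy => hpos y ⟨hmid.1.trans_le hy.1, hy.2.trans_lt ht.2⟩) hP).1
    · obtain ⟨Q, hQ⟩ := H.exists_momentum (t := t) (hs.trans ht.1.le)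
      have := (H.momentum_const (hs.trans ht.1.le) h1
        (fun y hy => hpos y ⟨ht.1.trans_le hy.1, hy.2.trans_lt hmid.2⟩) hQ).1
      rwa [tendsto_nhds_unique hP this]
  refine ⟨P, fun t ht => ⟨conv t ht, ?_⟩⟩
  have ht0 : 0 < t := hs.trans_lt ht.1
  have aff : ∀ y ∈ Ioo s r,
      (1 + a) * h y - ξ y = ((1 + a) * h t - ξ t) + P * (y - t) := by
    intro y hy
    rcases le_total t y with h1 | h1
    · linarith [(H.momentum_const ht0.le h1
        (fun z hz => hpos z ⟨ht.1.trans_le hz.1, hz.2.trans_lt hy.2⟩) (conv t ht)).2]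
    · have := (H.momentum_const (hs.trans hy.1.le) h1
        (fun z hz => hpos z ⟨hy.1.trans_le hz.1, hz.2.trans_lt ht.2⟩) (conv y hy)).2
      linarith
  have d1 : HasDerivAt (fun y => (1 + a) * h y - ξ y) P t := by
    have : HasDerivAt (fun y => ((1 + a) * h t - ξ t) + P * (y - t)) P t := by
      simpa using (((hasDerivAt_id t).sub_const t).const_mul P).const_add ((1 + a) * h t - ξ t)
    refine this.congr_of_eventuallyEq ?_
    filter_upwards [Ioo_mem_nhds ht.1 ht.2] with y hy using aff y hy
  have d2 := (d1.sub (H.hasDerivAt_sub ht0)).div_const a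
  refine d2.congr_of_eventuallyEq (Eventually.of_forall fun y => ?_)
  simp only [Pi.sub_apply]
  field_simp
  ring

/-- An excursion from the wall starts with velocity zero: `h` has velocity `(u s - u t) / a` after
leaving the wall at time `s`. It cannot start downwards, and an upward jump of the velocity is
excluded since the drag only slows the body down while the elastic force is bounded. -/
lemma hasDerivAt_of_excursion (H : IsVanishingLimit a b D h₀ v₀ V X C U μ hn ξn vn un h ξ u)
    {s r : ℝ} (hs : 0 < s) (hsr : s < r) (hs0 : h s = 0) (hpos : ∀ t ∈ Ioo s r, 0 < h t) :
    ∀ t ∈ Ioo s r, HasDerivAt h ((u s - u t) / a) t := by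
  have ha := H.a_pos
  have hC := H.C_pos
  have haC : 0 < a * C := mul_pos ha hC
  obtain ⟨P, hP⟩ := H.exists_momentum_Ioo hs.le hsr hpos
  suffices hPu : P = u s by
    intro t ht
    rw [← hPu]
    exact (hP t ht).2
  apply le_antisymm
  · by_contra hlt
    push Not at hlt
    set κ := (P - u s) / (2 * a) with hκ
    have hκ0 : 0 < κ := div_pos (sub_pos.2 hlt) (by positivity)
    set ρ := min (min s ((r - s) / 2)) (κ / (4 * (C + 1))) with hρ
    have hρ0 : 0 < ρ := by
      simp only [hρ, lt_min_iff]
      exact ⟨⟨hs, by linarith⟩, by positivity⟩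
    have hρ1 : ρ ≤ s := (min_le_left _ _).trans (min_le_left _ _)
    have hρ2 : ρ ≤ (r - s) / 2 := (min_le_left _ _).trans (min_le_right _ _)
    have hρ3 : (C + 1) * ρ ≤ κ / 4 := by
      have := min_le_right (min s ((r - s) / 2)) (κ / (4 * (C + 1)))
      rw [← hρ, le_div_iff₀ (by positivity)] at this
      linarith
    have ht : s + ρ ∈ Ioo s r := ⟨by linarith, by linarith⟩
    have hv : Tendsto (fun n => vn n (s + ρ)) U (𝓝 ((P - u (s + ρ)) / a)) := by
      have := ((hP _ ht).1.sub (H.tendsto_u (s + ρ) (by linarith))).div_const a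
      refine this.congr fun n => ?_
      field_simp
      ring
    have hlim : κ < (P - u (s + ρ)) / a := by
      have h1 := (abs_le.1 (H.lip_u hs.le (by linarith : 0 ≤ s + ρ))).2
      rw [show s + ρ - s = ρ by ring, abs_of_pos hρ0] at h1
      have h2 : P - u s = 2 * a * κ := by rw [hκ]; field_simp
      rw [lt_div_iff₀ ha]
      have h3 : a * (C * ρ) ≤ a * (κ / 4) := mul_le_mul_of_nonneg_left (by linarith) ha.le
      nlinarith
    have hfin : ∀ᶠ n in U, κ / 2 * ρ ≤ hn n s := by
      filter_upwards [hv.eventually_const_lt hlim] with n hvn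
      have hT := H.traj n
      have low : ∀ x ∈ Ioo (s - ρ) s, κ / 2 ≤ vn n x := by
        intro x hx
        by_contra hvx
        push Not at hvx
        have := hT.velocity_le (H.μ_pos n) H.D_pos (C := C + 1) (m := κ / 2) (x := x) (t := s + ρ)
          (by linarith [hx.1]) (by linarith [hx.2]) (by positivity) (by positivity)
          (fun y hy => by
            have hy0 : 0 ≤ y := by linarith [hx.1, hy.1]
            linarith [neg_abs_le (b (ξn n y)), H.b_le _ (H.ξ_le n y hy0)]) hvx.le
        have h4 : (C + 1) * (s + ρ - x) ≤ (C + 1) * (2 * ρ) :=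
          mul_le_mul_of_nonneg_left (by linarith [hx.1]) (by positivity)
        linarith
      have h5 := add_le_of_le_hasDerivAt (f := hn n) (f' := vn n) (a := s - ρ) (b := s)
        (by linarith) (hT.continuousOn_h.mono fun y hy => by
          rw [mem_Ici]; linarith [hy.1])
        (fun y hy => hasDerivAt_of_hasDerivWithinAt_Ici (hT.deriv_h y (by linarith [hy.1]))
          (by linarith [hy.1])) low
      have h6 := hT.pos (s - ρ) (by linarith)
      rw [show s - (s - ρ) = ρ by ring] at h5
      linarith
    have := ge_of_tendsto (H.tendsto_h s hs.le) hfin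
    rw [hs0] at this
    have : 0 < κ / 2 * ρ := by positivity
    linarith
  · by_contra hlt
    push Not at hlt
    set ρ := min ((r - s) / 2) ((u s - P) / (a * C)) with hρ
    have hρ0 : 0 < ρ := lt_min (by linarith) (div_pos (by linarith) haC)
    have hρ2 : ρ ≤ (r - s) / 2 := min_le_left _ _
    have hρ3 : a * C * ρ ≤ u s - P := by
      have := min_le_right ((r - s) / 2) ((u s - P) / (a * C))
      rw [← hρ, le_div_iff₀ haC] at this
      linarith
    have h1 := le_add_of_hasDerivAt_le (f := h) (a := s) (b := s + ρ) (C := 0) (by linarith)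
      (H.continuousOn_h.mono fun y hy => hs.le.trans hy.1)
      (fun t ht => (hP t ⟨ht.1, by linarith [ht.2]⟩).2)
      (fun t ht => by
        have h2 := (abs_le.1 (H.lip_u hs.le (hs.le.trans ht.1.le))).1
        rw [abs_of_pos (sub_pos.2 ht.1)] at h2
        have h3 : a * C * (t - s) ≤ a * C * ρ :=
          mul_le_mul_of_nonneg_left (by linarith [ht.2]) haC.le
        exact div_nonpos_of_nonpos_of_nonneg (by linarith) ha.le)
    have h4 := hpos (s + ρ) ⟨by linarith, by linarith⟩
    linarith

/-- The body cannot leave the wall while the spring is compressed. -/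
lemma false_of_excursion_of_nonneg
    (H : IsVanishingLimit a b D h₀ v₀ V X C U μ hn ξn vn un h ξ u)
    {s t : ℝ} (hs : 0 < s) (hst : s < t) (hs0 : h s = 0) (hpos : ∀ y ∈ Ioc s t, 0 < h y)
    (hξ : ∀ y ∈ Ioo s t, 0 ≤ ξ y) : False := by
  have hd := H.hasDerivAt_of_excursion hs hst hs0 fun y hy => hpos y ⟨hy.1, hy.2.le⟩
  have h1 := le_add_of_hasDerivAt_le (f := h) (C := 0) hst.le
    (H.continuousOn_h.mono fun y hy => hs.le.trans hy.1) hd ?_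
  · have := hpos t (right_mem_Ioc.2 hst)
    linarith
  · intro y hy
    have h2 := add_le_of_le_hasDerivAt (f := u) (C := 0) hy.1.le
      (H.continuousOn_u.mono fun z hz => hs.le.trans hz.1)
      (fun z hz => H.hasDerivAt_u (hs.trans hz.1))
      (fun z hz => mul_nonneg H.a_pos.le
        (nonneg_of_sign H.b_cont H.b_sign (hξ z ⟨hz.1, hz.2.trans hy.2⟩)))
    exact div_nonpos_of_nonpos_of_nonneg (by linarith) H.a_pos.le

/-- A body that left the wall with an extended spring and positive momentum does not return. At the
time of return the conserved momentum forces `|u|` to have grown, hence by conservation of energy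
the potential to have dropped, while the drift of the center of mass forces a larger extension. -/
lemma false_of_return (H : IsVanishingLimit a b D h₀ v₀ V X C U μ hn ξn vn un h ξ u)
    {s r : ℝ} (hs : 0 < s) (hsr : s < r) (hs0 : h s = 0) (hr0 : h r = 0)
    (hpos : ∀ y ∈ Ioo s r, 0 < h y) (hξ : ξ s ≤ 0) (hu : 0 < u s) : False := by
  have ha := H.a_pos
  have haC : 0 < a * C := mul_pos ha H.C_pos
  have hd := H.hasDerivAt_of_excursion hs hsr hs0 hpos
  have sub : Icc s r ⊆ Ici 0 := fun y hy => hs.le.trans hy.1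
  have dξ : ∀ t ∈ Ioo s r, HasDerivAt ξ ((u s - u t) / a - u t) t := by
    intro t ht
    refine ((hd t ht).sub (H.hasDerivAt_sub (hs.trans ht.1))).congr_of_eventuallyEq
      (Eventually.of_forall fun y => ?_)
    simp
  have cu := H.continuousOn_u.mono sub
  have cξ := H.continuousOn_ξ.mono sub
  have ch := H.continuousOn_h.mono sub
  have hur : u s ≤ u r := by
    by_contra hlt
    push Not at hlt
    set ρ := min ((r - s) / 2) ((u s - u r) / (a * C)) with hρ
    have hρ0 : 0 < ρ := lt_min (by linarith) (div_pos (by linarith) haC)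
    have hρ2 : ρ ≤ (r - s) / 2 := min_le_left _ _
    have hρ3 : a * C * ρ ≤ u s - u r := by
      have := min_le_right ((r - s) / 2) ((u s - u r) / (a * C))
      rw [← hρ, le_div_iff₀ haC] at this
      linarith
    have h1 := add_le_of_le_hasDerivAt (f := h) (a := r - ρ) (b := r) (C := 0) (by linarith)
      (ch.mono (Icc_subset_Icc_left (by linarith)))
      (fun t ht => hd t ⟨by linarith [ht.1], ht.2⟩)
      (fun t ht => by
        have ht0 : 0 ≤ t := by linarith [ht.1]
        have h2 := (abs_le.1 (H.lip_u (hs.trans hsr).le ht0)).2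
        rw [abs_sub_comm t r, abs_of_pos (sub_pos.2 ht.2)] at h2
        have h3 : a * C * (r - t) ≤ a * C * ρ :=
          mul_le_mul_of_nonneg_left (by linarith [ht.1]) haC.le
        exact div_nonneg (by linarith) ha.le)
    have h4 := hpos (r - ρ) ⟨by linarith, by linarith⟩
    linarith
  have energy := le_add_of_hasDerivAt_le (C := 0) hsr.le
    (f := fun t => u t ^ 2 / (2 * a) + ((u s - u t) / a) ^ 2 / 2 + elasticPotential b (ξ t))
    (f' := fun _ => 0)
    ((((cu.pow 2).div_const _).add ((((continuousOn_const.sub cu).div_const a).pow 2).div_const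
      2)).add ((continuous_elasticPotential H.b_cont).comp_continuousOn cξ))
    (fun t ht => by
      have du := H.hasDerivAt_u (hs.trans ht.1)
      refine ((((du.pow 2).div_const (2 * a)).add
        ((((du.const_sub (u s)).div_const a).pow 2).div_const 2)).add
        ((hasDerivAt_elasticPotential H.b_cont (ξ t)).comp t (dξ t ht))).congr_deriv ?_
      simp only [Nat.cast_ofNat, Nat.add_one_sub_one, pow_one]
      field_simp
      ring)
    (fun t ht => le_rfl)
  have drift := le_add_of_hasDerivAt_le (f := fun t => ξ t - (1 + a) * h t) hsr.le
    (cξ.sub (ch.const_mul _)) (f' := fun _ => -u s) (C := -u s)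
    (fun t ht => ((dξ t ht).sub ((hd t ht).const_mul (1 + a))).congr_deriv (by field_simp; ring))
    (fun t ht => le_rfl)
  simp only [hs0, hr0, mul_zero, sub_zero] at drift
  have hdr : 0 < u s * (r - s) := mul_pos hu (sub_pos.2 hsr)
  have hlt : ξ r < ξ s := by linarith
  have hB := strictAntiOn_elasticPotential H.b_cont H.b_sign (hlt.le.trans hξ) hξ hlt
  have h1 : u s ^ 2 / (2 * a) ≤ u r ^ 2 / (2 * a) := by gcongr
  simp only [sub_self, zero_div, zero_mul, add_zero] at energy
  have h2 : 0 ≤ ((u s - u r) / a) ^ 2 / 2 := by positivity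
  norm_num at energy
  linarith

/-! ### Approach to the wall -/

/-- Before the first contact the spring stays unstrained, because among all states with momentum
`(1 + a) v₀` the initial one has the least energy. -/
lemma ξ_eq_zero_of_pos (H : IsVanishingLimit a b D h₀ v₀ V X C U μ hn ξn vn un h ξ u) {t : ℝ}
    (ht : 0 ≤ t) (hpos : ∀ y ∈ Icc 0 t, 0 < h y) : ξ t = 0 := by
  have ha := H.a_pos
  have hP0 : Tendsto (fun n => a * vn n 0 + un n 0) U (𝓝 (a * v₀ + v₀)) := by
    simp [(H.traj _).v_zero, (H.traj _).u_zero]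
  have hP := (H.momentum_const le_rfl ht hpos hP0).1
  have h1 : elasticPotential b (ξ t) ≤ v₀ ^ 2 / (2 * a) + v₀ ^ 2 / 2 -
      (a * v₀ + v₀) ^ 2 / (2 * a * (1 + a)) := by
    refine le_of_tendsto_of_tendsto
      (((continuous_elasticPotential H.b_cont).tendsto _).comp (H.tendsto_ξ t ht))
      (((hP.pow 2).div_const (2 * a * (1 + a))).const_sub (v₀ ^ 2 / (2 * a) + v₀ ^ 2 / 2))
      (Eventually.of_forall fun n => ?_)
    have h2 := (H.traj n).energy_le ha (H.μ_pos n) H.b_cont H.D_pos ht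
    have h3 : (a * vn n t + un n t) ^ 2 / (2 * a * (1 + a)) ≤
        un n t ^ 2 / (2 * a) + vn n t ^ 2 / 2 := by
      rw [div_add_div _ _ (by positivity) (by positivity), div_le_div_iff₀ (by positivity)
        (by positivity)]
      nlinarith [mul_nonneg (mul_nonneg ha.le ha.le) (sq_nonneg (vn n t - un n t))]
    simp only [Function.comp_apply]
    linarith
  have h2 : v₀ ^ 2 / (2 * a) + v₀ ^ 2 / 2 - (a * v₀ + v₀) ^ 2 / (2 * a * (1 + a)) = 0 := by
    field_simp
    ring
  rw [h2] at h1
  by_contra hne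
  exact absurd (elasticPotential_pos H.b_cont H.b_sign hne) (not_lt.2 h1)

lemma free_flight_of_pos (H : IsVanishingLimit a b D h₀ v₀ V X C U μ hn ξn vn un h ξ u) {t : ℝ}
    (ht : 0 ≤ t) (hpos : ∀ y ∈ Icc 0 t, 0 < h y) :
    ξ t = 0 ∧ u t = v₀ ∧ h t = h₀ + v₀ * t := by
  have hξ : ∀ y ∈ Icc 0 t, ξ y = 0 := fun y hy =>
    H.ξ_eq_zero_of_pos hy.1 fun z hz => hpos z ⟨hz.1, hz.2.trans hy.2⟩
  have hu : ∀ y ∈ Icc 0 t, u y = v₀ := by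
    intro y hy
    have cu : ContinuousOn u (Icc 0 y) := H.continuousOn_u.mono Icc_subset_Ici_self
    have du : ∀ z ∈ Ioo 0 y, HasDerivAt u 0 z := fun z hz =>
      (H.hasDerivAt_u hz.1).congr_deriv (by
        rw [hξ z ⟨hz.1.le, hz.2.le.trans hy.2⟩, zero_of_sign H.b_cont H.b_sign, mul_zero])
    have h1 := le_add_of_hasDerivAt_le hy.1 cu du (C := 0) fun _ _ => le_rfl
    have h2 := add_le_of_le_hasDerivAt hy.1 cu du (C := 0) fun _ _ => le_rfl
    rw [H.u_zero] at h1 h2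
    linarith
  refine ⟨hξ t (right_mem_Icc.2 ht), hu t (right_mem_Icc.2 ht), ?_⟩
  have cq : ContinuousOn (fun s => h s - ξ s) (Icc 0 t) :=
    (H.continuousOn_h.sub H.continuousOn_ξ).mono Icc_subset_Ici_self
  have dq : ∀ z ∈ Ioo 0 t, HasDerivAt (fun s => h s - ξ s) v₀ z := fun z hz =>
    (H.hasDerivAt_sub hz.1).congr_deriv (hu z ⟨hz.1.le, hz.2.le⟩)
  have h1 := le_add_of_hasDerivAt_le ht cq dq (C := v₀) fun _ _ => le_rfl
  have h2 := add_le_of_le_hasDerivAt ht cq dq (C := v₀) fun _ _ => le_rfl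
  simp only [H.h_zero, H.ξ_zero, hξ t (right_mem_Icc.2 ht)] at h1 h2
  linarith

/-- Free flight with velocity `v₀` until the contact time `-h₀ / v₀`. -/
lemma free_flight (H : IsVanishingLimit a b D h₀ v₀ V X C U μ hn ξn vn un h ξ u) (hh₀ : 0 < h₀)
    (hv₀ : v₀ < 0) {t : ℝ} (ht : t ∈ Icc 0 (-h₀ / v₀)) :
    ξ t = 0 ∧ u t = v₀ ∧ h t = h₀ + v₀ * t := by
  have height : ∀ y, y < -h₀ / v₀ → 0 < h₀ + v₀ * y := by
    intro y hy
    rw [lt_div_iff_of_neg hv₀] at hy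
    linarith
  have ext : ∀ r, 0 < r → (∀ y ∈ Ico 0 r, 0 < h y) →
      ξ r = 0 ∧ u r = v₀ ∧ h r = h₀ + v₀ * r := by
    intro r hr hpos
    have hI : ∀ y ∈ Ico 0 r, ξ y = 0 ∧ u y = v₀ ∧ h y = h₀ + v₀ * y := fun y hy =>
      H.free_flight_of_pos hy.1 fun z hz => hpos z ⟨hz.1, hz.2.trans_lt hy.2⟩
    have sub : Icc 0 r ⊆ Ici (0 : ℝ) := Icc_subset_Ici_self
    refine ⟨eq_zero_of_forall_Ico hr (H.continuousOn_ξ.mono sub) fun y hy => (hI y hy).1, ?_, ?_⟩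
    · have := eq_zero_of_forall_Ico (f := fun y => u y - v₀) hr
        ((H.continuousOn_u.mono sub).sub continuousOn_const) fun y hy => by simp [(hI y hy).2.1]
      linarith
    · have := eq_zero_of_forall_Ico (f := fun y => h y - (h₀ + v₀ * y)) hr
        ((H.continuousOn_h.mono sub).sub (by fun_prop)) fun y hy => by simp [(hI y hy).2.2]
      linarith
  rcases ht.1.eq_or_lt with h0 | h0
  · rw [← h0]
    simp [H.ξ_zero, H.u_zero, H.h_zero]
  · apply ext t h0
    intro y hy
    by_contra hle
    obtain ⟨r, hr, hr0, hr1⟩ := exists_first_zero hy.1 (H.continuousOn_h.mono Icc_subset_Ici_self)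
      (by rw [H.h_zero]; exact hh₀) (not_lt.1 hle)
    have h1 := (ext r hr.1 hr1).2.2
    have h2 := height r (hr.2.trans_lt (hy.2.trans_le ht.2))
    linarith

/-! ### Rebound -/

/-- The limit cannot stay at the wall while the deformation descends from the region where the
drag is strong into the region `ξ < -δ₂` where it is weak. Until time `τ` the drag bounds
`μ h ^ (1 - γ₁)`; from then on the elastic force keeps the body ascending, so this bound persists;
and on `[t₁, t₂]` the drag impulse is negligible, so the elastic force lifts the body off the wall
by a height independent of `n`. -/
lemma false_of_stuck (H : IsVanishingLimit a b D h₀ v₀ V X C U μ hn ξn vn un h ξ u)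
    {δ₁ c₁ γ₁ δ₂ σ τ t₁ t₂ : ℝ} {γ : ℝ → ℝ} (hc₁ : 0 < c₁) (hγ₁ : 1 ≤ γ₁)
    (hD_mono : ∀ x : ℝ, 0 < x → ∀ ξ₁ ξ₂ : ℝ, ξ₁ ≤ ξ₂ → D x ξ₁ ≤ D x ξ₂)
    (hD_sing : ∀ x : ℝ, 0 < x → c₁ * x ^ (-γ₁) ≤ D x (-δ₁))
    (hγ_nonneg : ∀ y : ℝ, 0 < y → 0 ≤ γ y)
    (hγ_int : ∃ r : ℝ, 0 < r ∧ IntegrableOn (fun y => γ y * y⁻¹) (Ioc 0 r))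
    (hγ_lim : Tendsto (fun h : ℝ => ∫ y in (0 : ℝ)..h, γ y * y⁻¹) (𝓝[>] 0) (𝓝 0))
    (hD_upper : ∀ x : ℝ, 0 < x → D x (-δ₂) ≤ γ x * x ^ (-γ₁))
    (h0σ : 0 ≤ σ) (hστ : σ < τ) (hτ1 : τ ≤ t₁) (h12 : t₁ < t₂)
    (hh : ∀ s ∈ Icc σ t₂, h s = 0) (hξ1 : ∀ s ∈ Icc 0 τ, -δ₁ < ξ s)
    (hξneg : ∀ s ∈ Icc σ t₂, ξ s < 0) (hξ2 : ∀ s ∈ Icc t₁ t₂, ξ s < -δ₂) : False := by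
  have hC := H.C_pos
  have h0τ : 0 < τ := h0σ.trans_lt hστ
  have h01 : 0 < t₁ := h0τ.trans_le hτ1
  have hσ2 : σ ≤ t₂ := by linarith
  obtain ⟨m, hm, hmξ⟩ := exists_pos_forall_le (f := fun s => -ξ s) hσ2
    (H.continuousOn_ξ.neg.mono fun s hs => h0σ.trans hs.1) fun s hs => neg_pos.2 (hξneg s hs)
  obtain ⟨m1, hm1, hm1ξ⟩ := exists_pos_forall_le (f := fun s => ξ s + δ₁) h0τ.le
    ((H.continuousOn_ξ.mono Icc_subset_Ici_self).add continuousOn_const)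
    fun s hs => by linarith [hξ1 s hs]
  obtain ⟨m2, hm2, hm2ξ⟩ := exists_pos_forall_le (f := fun s => -δ₂ - ξ s) h12.le
    (continuousOn_const.sub (H.continuousOn_ξ.mono fun s hs => h01.le.trans hs.1))
    fun s hs => by linarith [hξ2 s hs]
  have hX : 0 ≤ X := (abs_nonneg _).trans (H.ξ_le 0 0 le_rfl)
  obtain ⟨β', hβ', hbβ'⟩ := exists_pos_forall_le (f := fun x => -b x)
    (show -(X + m) ≤ -(m / 2) by linarith) H.b_cont.neg.continuousOn
    fun x hx => neg_pos.2 (neg_of_sign H.b_sign (by linarith [hx.2]))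
  set β := β' / 2 with hβdef
  have hβ : 0 < β := half_pos hβ'
  set κ := c₁ / γ₁ with hκ
  have hκ0 : 0 < κ := div_pos hc₁ (by linarith)
  set A := (|v₀| + 1 + C * τ) / κ with hA
  have hA0 : 0 < A := by positivity
  set ℓ := t₂ - t₁ with hℓ
  have hℓ0 : 0 < ℓ := sub_pos.2 h12
  obtain ⟨r, hr, hrint⟩ := hγ_int
  have hlim := hγ_lim.eventually_lt_const (show 0 < β * ℓ / (4 * A) by positivity)
  rw [eventually_nhdsWithin_iff, Metric.eventually_nhds_iff] at hlim
  obtain ⟨ρ, hρ, hρint⟩ := hlim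
  have e1 := eventually_forall_abs_sub_lt H.lip_ξn H.tendsto_ξ (q := t₂) h0σ (half_pos hm)
  have e2 := eventually_forall_abs_sub_lt H.lip_ξn H.tendsto_ξ (q := τ) le_rfl hm1
  have e3 := eventually_forall_abs_sub_lt H.lip_ξn H.tendsto_ξ (q := t₂) h01.le hm2
  have e4 := eventually_forall_abs_sub_lt H.lip_hn H.tendsto_h (q := t₂) h0σ
    (show 0 < min (min r ρ) (min (β * (τ - σ) ^ 2 / 4) (β * ℓ ^ 2 / 8)) by
      have : 0 < τ - σ := sub_pos.2 hστ
      simp only [lt_min_iff]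
      exact ⟨⟨hr, hρ⟩, by positivity, by positivity⟩)
  have e5 : ∀ᶠ n in U, μ n * κ * h₀ ^ (1 - γ₁) < 1 := by
    have : Tendsto (fun n => μ n * κ * h₀ ^ (1 - γ₁)) U (𝓝 0) := by
      simpa using (H.μ_tendsto.mul_const κ).mul_const (h₀ ^ (1 - γ₁))
    exact this.eventually_lt_const one_pos
  obtain ⟨n, h1, h2, h3, h4, h5⟩ := (e1.and (e2.and (e3.and (e4.and e5)))).exists
  have hT := H.traj n
  have hμ := H.μ_pos n
  have small : ∀ s ∈ Icc σ t₂, hn n s < r ∧ hn n s < ρ ∧ hn n s < β * (τ - σ) ^ 2 / 4 ∧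
      hn n s < β * ℓ ^ 2 / 8 := by
    intro s hs
    have := h4 s hs
    rw [hh s hs, sub_zero, abs_of_pos (hT.pos s (h0σ.trans hs.1))] at this
    simp only [lt_min_iff] at this
    exact ⟨this.1.1, this.1.2, this.2.1, this.2.2⟩
  have force : ∀ s ∈ Icc σ t₂, β < -b (ξn n s) := by
    intro s hs
    have i1 := (abs_lt.1 (h1 s hs)).2
    have i2 := (abs_le.1 (H.ξ_le n s (h0σ.trans hs.1))).1
    have i3 := hmξ s hs
    have i4 := hbβ' (ξn n s) ⟨by linarith, by linarith⟩
    linarith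
  have ascend : ∀ s ∈ Icc τ t₂, 0 ≤ vn n s := by
    intro s hs
    refine hT.velocity_nonneg hμ H.D_pos h0σ (hστ.le.trans hs.1) hβ
      (fun y hy => force y ⟨hy.1, hy.2.trans hs.2⟩) ?_
    refine (small σ (left_mem_Icc.2 hσ2)).2.2.1.le.trans ?_
    have hsub : 0 ≤ τ - σ := sub_nonneg.2 hστ.le
    have : (τ - σ) ^ 2 ≤ (s - σ) ^ 2 := pow_le_pow_left₀ hsub (by linarith [hs.1]) 2
    have := mul_le_mul_of_nonneg_left this hβ.le
    linarith
  have impulse : μ n * hn n τ ^ (1 - γ₁) ≤ A := by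
    have i1 := hT.mul_rpow_le hμ (δ₁ := δ₁) (C := C) hc₁ hγ₁ hD_mono hD_sing h0τ.le
      (fun s hs => by linarith [(abs_lt.1 (h2 s hs)).1, hm1ξ s hs]) hC.le
      (fun s hs => (le_abs_self _).trans (H.b_le _ (H.ξ_le n s hs.1)))
    rw [hA, le_div_iff₀ hκ0]
    nlinarith
  have hmono : hn n τ ≤ hn n t₁ := by
    simpa using add_le_of_le_hasDerivAt (f := hn n) (f' := vn n) (C := 0) hτ1
      (hT.continuousOn_h.mono fun y hy => h0τ.le.trans hy.1)
      (fun y hy => hasDerivAt_of_hasDerivWithinAt_Ici (hT.deriv_h y (h0τ.trans hy.1).le)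
        (h0τ.trans hy.1))
      (fun y hy => ascend y ⟨hy.1.le, hy.2.le.trans h12.le⟩)
  have impulse' : μ n * hn n t₁ ^ (1 - γ₁) ≤ A :=
    (mul_le_mul_of_nonneg_left (Real.rpow_le_rpow_of_nonpos (hT.pos τ h0τ.le) hmono
      (by linarith)) hμ.le).trans impulse
  have lift : ∀ s ∈ Ioo ((t₁ + t₂) / 2) t₂, β * ℓ / 4 ≤ vn n s := by
    intro s hs
    have hs1 : t₁ ≤ s := by linarith [hs.1]
    have hsm : s ∈ Icc σ t₂ := ⟨by linarith, hs.2.le⟩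
    have i1 := hT.le_velocity hμ (β := β) (A := A) (r := r) (ε := β * ℓ / (4 * A)) hγ₁ hD_mono
      hγ_nonneg hrint hD_upper h01.le hs1
      (fun y hy => ascend y ⟨hτ1.trans hy.1, hy.2.trans hs.2.le⟩)
      (fun y hy => by
        have hy' : y ∈ Icc t₁ t₂ := ⟨hy.1, hy.2.trans hs.2.le⟩
        linarith [(abs_lt.1 (h3 y hy')).2, hm2ξ y hy'])
      (fun y hy => (force y ⟨by linarith [hy.1], hy.2.trans hs.2.le⟩).le)
      impulse' (small s hsm).1.le
      (by
        have hp := hT.pos s (h01.le.trans hs1)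
        refine (hρint (y := hn n s) ?_ hp).le
        rw [Real.dist_eq, sub_zero, abs_of_pos hp]
        exact (small s hsm).2.1)
    have i2 : A * (β * ℓ / (4 * A)) = β * ℓ / 4 := by field_simp
    have i3 : β * (ℓ / 2) ≤ β * (s - t₁) := mul_le_mul_of_nonneg_left (by linarith [hs.1]) hβ.le
    linarith
  have final := add_le_of_le_hasDerivAt (f := hn n) (f' := vn n) (a := (t₁ + t₂) / 2) (b := t₂)
    (by linarith) (hT.continuousOn_h.mono fun y hy => by rw [mem_Ici]; linarith [hy.1])
    (fun y hy => hasDerivAt_of_hasDerivWithinAt_Ici (hT.deriv_h y (by linarith [hy.1]))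
        (by linarith [hy.1])) lift
  have i1 := hT.pos ((t₁ + t₂) / 2) (by linarith)
  have i2 := (small t₂ (right_mem_Icc.2 hσ2)).2.2.2
  have i3 : t₂ - (t₁ + t₂) / 2 = ℓ / 2 := by rw [hℓ]; ring
  rw [i3] at final
  nlinarith

end IsVanishingLimit

/-! ### The oscillator of a body resting at the wall -/

/-- On `[p, q]` the body rests at the wall: the deformation satisfies `ξ'' = -a b(ξ)`, written with
`u = -ξ'`, and starts from `ξ = 0` with velocity `-v₀`. -/
structure IsWallOscillation (a : ℝ) (b : ℝ → ℝ) (v₀ p q : ℝ) (ξ u : ℝ → ℝ) : Prop where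
  le : p ≤ q
  cont_ξ : ContinuousOn ξ (Icc p q)
  cont_u : ContinuousOn u (Icc p q)
  deriv_ξ : ∀ t ∈ Ioo p q, HasDerivAt ξ (-u t) t
  deriv_u : ∀ t ∈ Ioo p q, HasDerivAt u (a * b (ξ t)) t
  ξ_left : ξ p = 0
  u_left : u p = v₀

/-- On the energy level of the oscillator the phase point turns about the origin with angular
speed at least `κ`. -/
lemma exists_angular_speed {a : ℝ} {b : ℝ → ℝ} {v₀ : ℝ} (ha : 0 < a) (hv₀ : v₀ ≠ 0)
    (hb : Continuous b) (hs : ∀ y : ℝ, y ≠ 0 → 0 < b y * y)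
    (hB : Tendsto (elasticPotential b) (cocompact ℝ) atTop) :
    ∃ κ, 0 < κ ∧ ∀ x y, y ^ 2 + 2 * a * elasticPotential b x = v₀ ^ 2 →
      κ * (x ^ 2 + y ^ 2) ≤ a * b x * x + y ^ 2 := by
  obtain ⟨X, hX, hX'⟩ := exists_abs_le_of_elasticPotential_le hB (v₀ ^ 2 / (2 * a))
  set K : Set (ℝ × ℝ) := {z | z.2 ^ 2 + 2 * a * elasticPotential b z.1 = v₀ ^ 2} with hK
  have hbound : ∀ z ∈ K, |z.1| ≤ X ∧ |z.2| ≤ |v₀| := by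
    intro z hz
    have h1 : z.2 ^ 2 + 2 * a * elasticPotential b z.1 = v₀ ^ 2 := hz
    have h2 : 0 ≤ 2 * a * elasticPotential b z.1 :=
      mul_nonneg (by positivity) (elasticPotential_nonneg hb hs _)
    refine ⟨hX' _ ?_, sq_le_sq.1 (by linarith)⟩
    rw [le_div_iff₀ (by positivity)]
    nlinarith [sq_nonneg z.2]
  have hcB := continuous_elasticPotential hb
  have hKc : IsCompact K := by
    refine ((isCompact_Icc (a := -X) (b := X)).prod
      (isCompact_Icc (a := -|v₀|) (b := |v₀|))).of_isClosed_subset ?_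
      fun z hz => ⟨abs_le.1 (hbound z hz).1, abs_le.1 (hbound z hz).2⟩
    exact isClosed_eq (by fun_prop) continuous_const
  obtain ⟨z, hz, hmin⟩ := hKc.exists_isMinOn ⟨(0, v₀), by simp [hK]⟩
    (f := fun z : ℝ × ℝ => a * b z.1 * z.1 + z.2 ^ 2) (by fun_prop)
  set m := a * b z.1 * z.1 + z.2 ^ 2 with hm
  have hm0 : 0 < m := by
    by_cases h0 : z.1 = 0
    · have h1 : z.2 ^ 2 + 2 * a * elasticPotential b z.1 = v₀ ^ 2 := hz
      rw [h0, elasticPotential_zero, mul_zero, add_zero] at h1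
      rw [hm, h0, mul_zero, zero_add, h1]
      positivity
    · have := mul_pos ha (hs _ h0)
      nlinarith [sq_nonneg z.2]
  have hR : 0 < X ^ 2 + v₀ ^ 2 := by positivity
  refine ⟨m / (X ^ 2 + v₀ ^ 2), div_pos hm0 hR, fun x y hxy => ?_⟩
  have h1 : m ≤ a * b x * x + y ^ 2 := hmin (a := (x, y)) hxy
  have h2 := hbound (x, y) hxy
  have h3 : x ^ 2 + y ^ 2 ≤ X ^ 2 + v₀ ^ 2 :=
    add_le_add (sq_le_sq.2 (h2.1.trans (le_abs_self X))) (sq_le_sq.2 h2.2)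
  calc m / (X ^ 2 + v₀ ^ 2) * (x ^ 2 + y ^ 2) ≤ m / (X ^ 2 + v₀ ^ 2) * (X ^ 2 + v₀ ^ 2) :=
        mul_le_mul_of_nonneg_left h3 (div_pos hm0 hR).le
    _ = m := div_mul_cancel₀ _ hR.ne'
    _ ≤ _ := h1

namespace IsWallOscillation

variable {a : ℝ} {b : ℝ → ℝ} {v₀ p q : ℝ} {ξ u : ℝ → ℝ}

lemma mono (O : IsWallOscillation a b v₀ p q ξ u) {r : ℝ} (hr : r ∈ Icc p q) :
    IsWallOscillation a b v₀ p r ξ u where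
  le := hr.1
  cont_ξ := O.cont_ξ.mono (Icc_subset_Icc_right hr.2)
  cont_u := O.cont_u.mono (Icc_subset_Icc_right hr.2)
  deriv_ξ := fun t ht => O.deriv_ξ t ⟨ht.1, ht.2.trans_le hr.2⟩
  deriv_u := fun t ht => O.deriv_u t ⟨ht.1, ht.2.trans_le hr.2⟩
  ξ_left := O.ξ_left
  u_left := O.u_left

lemma energy (O : IsWallOscillation a b v₀ p q ξ u) (hb : Continuous b) {t : ℝ}
    (ht : t ∈ Icc p q) : u t ^ 2 + 2 * a * elasticPotential b (ξ t) = v₀ ^ 2 := by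
  have hc : ContinuousOn (fun s => u s ^ 2 + 2 * a * elasticPotential b (ξ s)) (Icc p t) :=
    ((O.cont_u.pow 2).add (((continuous_elasticPotential hb).comp_continuousOn
      O.cont_ξ).const_mul _)).mono (Icc_subset_Icc_right ht.2)
  have hd : ∀ s ∈ Ioo p t,
      HasDerivAt (fun s => u s ^ 2 + 2 * a * elasticPotential b (ξ s)) 0 s := by
    intro s hs
    have hs' : s ∈ Ioo p q := ⟨hs.1, hs.2.trans_le ht.2⟩
    refine (((O.deriv_u s hs').pow 2).add (((hasDerivAt_elasticPotential hb (ξ s)).comp s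
      (O.deriv_ξ s hs')).const_mul (2 * a))).congr_deriv ?_
    norm_num
    ring
  have h1 := le_add_of_hasDerivAt_le ht.1 hc hd (C := 0) fun _ _ => le_rfl
  have h2 := add_le_of_le_hasDerivAt ht.1 hc hd (C := 0) fun _ _ => le_rfl
  simp only [O.ξ_left, O.u_left, elasticPotential_zero] at h1 h2
  linarith

/-- The compression phase lasts at most `π / κ`, since the phase `arctan (u / ξ)` increases at rate
at least `κ` during it. -/
lemma compression_time_le (O : IsWallOscillation a b v₀ p q ξ u) (hb : Continuous b) {κ : ℝ}
    (hκ : 0 < κ) (hκ' : ∀ x y, y ^ 2 + 2 * a * elasticPotential b x = v₀ ^ 2 →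
      κ * (x ^ 2 + y ^ 2) ≤ a * b x * x + y ^ 2)
    (hpos : ∀ t ∈ Ioo p q, 0 < ξ t) : q - p ≤ Real.pi / κ := by
  by_contra hlt
  push Not at hlt
  set e := (q - p - Real.pi / κ) / 2 with he
  have he0 : 0 < e := by linarith
  have hπ : 0 < Real.pi / κ := div_pos Real.pi_pos hκ
  have hsub : ∀ t ∈ Icc (p + e) (q - e), t ∈ Ioo p q := fun t ht =>
    ⟨by linarith [ht.1], by linarith [ht.2]⟩
  have hd : ∀ t ∈ Icc (p + e) (q - e), HasDerivAt (fun s => Real.arctan (u s / ξ s))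
      ((a * b (ξ t) * ξ t + u t ^ 2) / (ξ t ^ 2 + u t ^ 2)) t := by
    intro t ht
    have hξ := hpos t (hsub t ht)
    refine (((O.deriv_u t (hsub t ht)).div (O.deriv_ξ t (hsub t ht)) hξ.ne').arctan).congr_deriv ?_
    have : 0 < ξ t ^ 2 + u t ^ 2 := by positivity
    simp only [Pi.div_apply]
    field_simp
    ring
  have h1 := add_le_of_le_hasDerivAt (a := p + e) (b := q - e) (C := κ) (by linarith)
    (fun t ht => (hd t ht).continuousAt.continuousWithinAt)
    (fun t ht => hd t ⟨ht.1.le, ht.2.le⟩)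
    (fun t ht => by
      have ht' : t ∈ Ioo p q := hsub t ⟨ht.1.le, ht.2.le⟩
      have hξ := hpos t ht'
      rw [le_div_iff₀ (by positivity)]
      exact hκ' _ _ (O.energy hb ⟨ht'.1.le, ht'.2.le⟩))
  have h2 := Real.neg_pi_div_two_lt_arctan (u (p + e) / ξ (p + e))
  have h3 := Real.arctan_lt_pi_div_two (u (q - e) / ξ (q - e))
  have h4 : q - e - (p + e) = Real.pi / κ := by linarith
  rw [h4, mul_div_cancel₀ _ hκ.ne'] at h1
  linarith

/-- If `ξ` takes a nonpositive value after the start, it is positive up to a first zero `s`, and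
from then on it decreases with speed at least `k` as long as it stays above `-δ`, where `k` is
the least speed which the energy allows on `[-δ, 0]`. -/
lemma exists_descent (O : IsWallOscillation a b v₀ p q ξ u) (ha : 0 < a) (hb : Continuous b)
    (hs : ∀ y : ℝ, y ≠ 0 → 0 < b y * y) (hv₀ : v₀ < 0) {δ k : ℝ} (hk : 0 < k)
    (hk' : k ^ 2 + 2 * a * elasticPotential b (-δ) ≤ v₀ ^ 2)
    (hδ : ∀ t ∈ Icc p q, -δ ≤ ξ t) {z : ℝ} (hz : z ∈ Ioc p q) (hz0 : ξ z ≤ 0) :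
    ∃ s ∈ Ioc p q, ξ s = 0 ∧ (∀ t ∈ Ioo p s, 0 < ξ t) ∧ (∀ t ∈ Icc s q, k ≤ u t) ∧
      ∀ t ∈ Icc s q, ξ t ≤ -k * (t - s) := by
  have hpq : p < q := hz.1.trans_le hz.2
  -- the initial compression
  obtain ⟨ε, hε, hεu⟩ : ∃ ε > 0, ∀ t ∈ Icc p q, t < p + ε → u t < 0 := by
    have h1 := (O.cont_u p (left_mem_Icc.2 hpq.le)).eventually (gt_mem_nhds (O.u_left ▸ hv₀))
    rw [eventually_nhdsWithin_iff, Metric.eventually_nhds_iff] at h1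
    obtain ⟨ε, hε, h2⟩ := h1
    refine ⟨ε, hε, fun t ht htε => h2 ?_ ht⟩
    rw [Real.dist_eq, abs_of_nonneg (sub_nonneg.2 ht.1)]
    linarith
  have start : ∀ t ∈ Ioc p q, t < p + ε → 0 < ξ t := by
    intro t ht htε
    have hm : StrictMonoOn ξ (Icc p t) := by
      refine strictMonoOn_of_deriv_pos (convex_Icc p t)
        (O.cont_ξ.mono (Icc_subset_Icc_right ht.2)) ?_
      intro y hy
      rw [interior_Icc] at hy
      have hy' : y ∈ Ioo p q := ⟨hy.1, hy.2.trans_le ht.2⟩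
      rw [(O.deriv_ξ y hy').deriv]
      exact neg_pos.2 (hεu y ⟨hy'.1.le, hy'.2.le⟩ (hy.2.trans htε))
    have := hm (left_mem_Icc.2 ht.1.le) (right_mem_Icc.2 ht.1.le) ht.1
    rwa [O.ξ_left] at this
  have hpz : p + ε ≤ z := by
    by_contra h
    exact absurd (start z hz (not_le.1 h)) (not_lt.2 hz0)
  obtain ⟨s, hsI, hs0, hspos⟩ := exists_first_zero (p := p + ε / 2) (q := z) (by linarith)
    (O.cont_ξ.mono (Icc_subset_Icc (by linarith) hz.2))
    (start _ ⟨by linarith, by linarith [hz.2]⟩ (by linarith)) hz0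
  have hps : p < s := by linarith [hsI.1]
  have hsq : s ≤ q := hsI.2.trans hz.2
  have hpos : ∀ t ∈ Ioo p s, 0 < ξ t := by
    intro t ht
    rcases lt_or_ge t (p + ε / 2) with h1 | h1
    · exact start t ⟨ht.1, ht.2.le.trans hsq⟩ (by linarith)
    · exact hspos t ⟨h1, ht.2⟩
  have hus : 0 < u s := by
    have h1 := O.energy hb (t := s) ⟨hps.le, hsq⟩
    rw [hs0, elasticPotential_zero, mul_zero, add_zero] at h1
    by_contra hneg
    have hus : u s < 0 := by
      refine lt_of_le_of_ne (not_lt.1 hneg) fun h0 => ?_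
      rw [h0] at h1
      nlinarith
    -- otherwise `ξ` would increase towards its zero `s` from positive values
    have h2 := (O.cont_u s ⟨hps.le, hsq⟩).eventually (gt_mem_nhds hus)
    rw [eventually_nhdsWithin_iff, Metric.eventually_nhds_iff] at h2
    obtain ⟨η, hη, h3⟩ := h2
    set x := max (s - η / 2) ((p + s) / 2) with hx
    have hxs : x < s := max_lt (by linarith) (by linarith)
    have hpx : p < x := lt_of_lt_of_le (by linarith) (le_max_right _ _)
    have hxη : s - η / 2 ≤ x := le_max_left _ _
    have h4 := add_le_of_le_hasDerivAt (f := ξ) (a := x) (b := s) (C := 0) hxs.le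
      (O.cont_ξ.mono (Icc_subset_Icc hpx.le hsq))
      (fun t ht => O.deriv_ξ t ⟨hpx.trans ht.1, ht.2.trans_le hsq⟩)
      (fun t ht => by
        have := h3 (y := t) (by
          rw [Real.dist_eq, abs_sub_comm, abs_of_pos (sub_pos.2 ht.2)]
          linarith [ht.1]) ⟨(hpx.trans ht.1).le, ht.2.le.trans hsq⟩
        linarith)
    have h5 := hpos x ⟨hpx, hxs⟩
    linarith
  have subI : ∀ t ∈ Icc s q, t ∈ Icc p q := fun t ht => ⟨hps.le.trans ht.1, ht.2⟩
  have speed : ∀ t ∈ Icc s q, ξ t ≤ 0 → k ^ 2 ≤ u t ^ 2 := by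
    intro t ht h0
    have h1 := O.energy hb (subI t ht)
    have h2 := hδ t (subI t ht)
    have h3 := (strictAntiOn_elasticPotential hb hs).antitoneOn (h2.trans h0 : -δ ∈ Iic 0) h0 h2
    have := mul_le_mul_of_nonneg_left h3 (show 0 ≤ 2 * a by positivity)
    linarith
  have descend : ∀ t ∈ Icc s q, ∀ c, (∀ y ∈ Ico s t, c ≤ u y) → ξ t ≤ -c * (t - s) := by
    intro t ht c hc
    have := le_add_of_hasDerivAt_le (f := ξ) (a := s) (b := t) (C := -c) ht.1
      (O.cont_ξ.mono (Icc_subset_Icc hps.le ht.2))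
      (fun y hy => O.deriv_ξ y ⟨hps.trans hy.1, hy.2.trans_le ht.2⟩)
      (fun y hy => neg_le_neg (hc y ⟨hy.1.le, hy.2⟩))
    rwa [hs0, zero_add] at this
  have upos : ∀ t ∈ Icc s q, 0 < u t := by
    intro t ht
    by_contra hneg
    obtain ⟨r, hr, hr0, hrpos⟩ := exists_first_zero ht.1
      (O.cont_u.mono (Icc_subset_Icc hps.le ht.2)) hus (not_lt.1 hneg)
    have hrI : r ∈ Icc s q := ⟨hr.1.le, hr.2.trans ht.2⟩
    have h1 := descend r hrI 0 fun y hy => (hrpos y hy).le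
    have h2 := speed r hrI (by linarith)
    rw [hr0] at h2
    nlinarith
  have uk : ∀ t ∈ Icc s q, k ≤ u t := by
    intro t ht
    have h1 := descend t ht 0 fun y hy => (upos y ⟨hy.1, hy.2.le.trans ht.2⟩).le
    exact le_of_sq_le_sq (speed t ht (by linarith)) (upos t ht).le
  exact ⟨s, ⟨hps, hsq⟩, hs0, hpos, uk, fun t ht => descend t ht k
    fun y hy => uk y ⟨hy.1, hy.2.le.trans ht.2⟩⟩

end IsWallOscillation

namespace IsVanishingLimit

variable {a : ℝ} {b : ℝ → ℝ} {D : ℝ → ℝ → ℝ} {h₀ v₀ V X C : ℝ}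
  {U : Ultrafilter ℕ} {μ : ℕ → ℝ} {hn ξn vn un : ℕ → ℝ → ℝ} {h ξ u : ℝ → ℝ}

lemma isWallOscillation (H : IsVanishingLimit a b D h₀ v₀ V X C U μ hn ξn vn un h ξ u)
    {p q : ℝ} (hp : 0 ≤ p) (hpq : p ≤ q) (hξ : ξ p = 0) (hu : u p = v₀)
    (hh : ∀ t ∈ Icc p q, h t = 0) : IsWallOscillation a b v₀ p q ξ u where
  le := hpq
  cont_ξ := H.continuousOn_ξ.mono fun _ ht => hp.trans ht.1
  cont_u := H.continuousOn_u.mono fun _ ht => hp.trans ht.1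
  deriv_ξ := fun t ht => by
    refine (H.hasDerivAt_sub (hp.trans_lt ht.1)).neg.congr_of_eventuallyEq ?_
    filter_upwards [Ioo_mem_nhds ht.1 ht.2] with y hy
    simp [hh y ⟨hy.1.le, hy.2.le⟩]
  deriv_u := fun t ht => H.hasDerivAt_u (hp.trans_lt ht.1)
  ξ_left := hξ
  u_left := hu

/-- There is a last time `S ≤ T` up to which the body rests at the wall; unless `S = T`, it is off
the wall at times arbitrarily close to the right of `S`. -/
lemma exists_rest_time (H : IsVanishingLimit a b D h₀ v₀ V X C U μ hn ξn vn un h ξ u)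
    {p T : ℝ} (hp : 0 ≤ p) (hpT : p ≤ T) (h0 : h p = 0) :
    ∃ S ∈ Icc p T, (∀ t ∈ Icc p S, h t = 0) ∧
      (S = T ∨ ∀ ε > 0, ∃ t ∈ Ioo S (S + ε), t ≤ T ∧ 0 < h t) := by
  set W := {t ∈ Icc p T | 0 < h t} with hW
  rcases W.eq_empty_or_nonempty with hE | hne
  · refine ⟨T, right_mem_Icc.2 hpT, fun t ht => ?_, Or.inl rfl⟩
    refine le_antisymm (not_lt.1 fun hlt => ?_) (H.h_nonneg (hp.trans ht.1))
    exact (hE ▸ (⟨ht, hlt⟩ : t ∈ W) : t ∈ (∅ : Set ℝ))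
  · have hbdd : BddBelow W := ⟨p, fun t ht => ht.1.1⟩
    have hpS : p ≤ sInf W := le_csInf hne fun t ht => ht.1.1
    have hST : sInf W ≤ T := by
      obtain ⟨t, ht⟩ := hne
      exact (csInf_le hbdd ht).trans ht.1.2
    have hIco : ∀ t ∈ Ico p (sInf W), h t = 0 := by
      intro t ht
      refine le_antisymm (not_lt.1 fun hlt => ?_) (H.h_nonneg (hp.trans ht.1))
      exact absurd (csInf_le hbdd ⟨⟨ht.1, ht.2.le.trans hST⟩, hlt⟩) (not_le.2 ht.2)
    have hS0 : h (sInf W) = 0 := by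
      rcases hpS.eq_or_lt with h1 | h1
      · rw [← h1, h0]
      · exact eq_zero_of_forall_Ico h1 (H.continuousOn_h.mono fun y hy => hp.trans hy.1) hIco
    refine ⟨sInf W, ⟨hpS, hST⟩, fun t ht => ?_, Or.inr fun ε hε => ?_⟩
    · rcases ht.2.eq_or_lt with h1 | h1
      · rw [h1, hS0]
      · exact hIco t ⟨ht.1, h1⟩
    · obtain ⟨t, ht, htε⟩ := exists_lt_of_csInf_lt hne (show sInf W < sInf W + ε by linarith)
      refine ⟨t, ⟨lt_of_le_of_ne (csInf_le hbdd ht) ?_, htε⟩, ht.1.2, ht.2⟩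
      intro heq
      have h1 := ht.2
      rw [← heq, hS0] at h1
      exact lt_irrefl _ h1

/-- If the spring is compressed just after the rest time `S`, the body cannot leave the wall. -/
lemma false_of_leaving_compressed
    (H : IsVanishingLimit a b D h₀ v₀ V X C U μ hn ξn vn un h ξ u) {S T ε : ℝ} (hS : 0 < S)
    (hS0 : h S = 0) (hleave : ∀ ε > 0, ∃ t ∈ Ioo S (S + ε), t ≤ T ∧ 0 < h t) (hε : 0 < ε)
    (hξ : ∀ t ∈ Ioo S (S + ε), 0 < ξ t) : False := by
  obtain ⟨t, ht, -, hht⟩ := hleave ε hε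
  obtain ⟨s, hs, hs0, hspos⟩ := exists_last_zero ht.1.le
    (H.continuousOn_h.mono fun y hy => hS.le.trans hy.1) hS0.le hht
  exact H.false_of_excursion_of_nonneg (hS.trans_le hs.1) hs.2 hs0 hspos
    fun y hy => (hξ y ⟨hs.1.trans_lt hy.1, hy.2.trans ht.2⟩).le

/-- If `u` is positive at the rest time `S`, the body leaves the wall for good, so it is not back
at time `T`. -/
lemma false_of_leaving_descending
    (H : IsVanishingLimit a b D h₀ v₀ V X C U μ hn ξn vn un h ξ u) {S T : ℝ} (hS : 0 < S)
    (hS0 : h S = 0) (hT0 : h T = 0)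
    (hleave : ∀ ε > 0, ∃ t ∈ Ioo S (S + ε), t ≤ T ∧ 0 < h t) (hu : 0 < u S) : False := by
  obtain ⟨ε, hε, hεu⟩ := exists_pos_right hS.le H.continuousOn_u hu
  obtain ⟨t, ht, htT, hht⟩ := hleave ε hε
  obtain ⟨s, hs, hs0, hspos⟩ := exists_last_zero ht.1.le
    (H.continuousOn_h.mono fun y hy => hS.le.trans hy.1) hS0.le hht
  have hs1 : 0 < s := hS.trans_le hs.1
  rcases le_or_gt (ξ s) 0 with hξ | hξ
  · obtain ⟨r, hr, hr0, hrpos⟩ := exists_first_zero htT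
      (H.continuousOn_h.mono fun y hy => (hS.trans ht.1).le.trans hy.1) hht hT0.le
    refine H.false_of_return hs1 (hs.2.trans hr.1) hs0 hr0 (fun y hy => ?_) hξ
      (hεu s ⟨hs.1, by linarith [hs.2, ht.2]⟩)
    rcases le_total y t with h1 | h1
    · exact hspos y ⟨hy.1, h1⟩
    · exact hrpos y ⟨h1, hy.2⟩
  · obtain ⟨η, hη, hηξ⟩ := exists_pos_right hs1.le H.continuousOn_ξ hξ
    refine H.false_of_excursion_of_nonneg (t := min t (s + η)) hs1
      (lt_min hs.2 (by linarith)) hs0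
      (fun y hy => hspos y ⟨hy.1, hy.2.trans (min_le_left _ _)⟩)
      fun y hy => (hηξ y ⟨hy.1.le, hy.2.le.trans (min_le_right _ _)⟩).le

/-- The limit is off the wall at every time `T` by which a body resting at the wall would have
reached the deformation `-δ`, where `δ₂ < δ` and the energy exceeds the potential at `-δ`. -/
lemma height_ne_zero (H : IsVanishingLimit a b D h₀ v₀ V X C U μ hn ξn vn un h ξ u)
    {δ₁ c₁ γ₁ δ₂ δ k κ T : ℝ} {γ : ℝ → ℝ} (hh₀ : 0 < h₀) (hv₀ : v₀ < 0) (hδ₁ : 0 < δ₁)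
    (hc₁ : 0 < c₁) (hγ₁ : 1 ≤ γ₁)
    (hD_mono : ∀ x : ℝ, 0 < x → ∀ ξ₁ ξ₂ : ℝ, ξ₁ ≤ ξ₂ → D x ξ₁ ≤ D x ξ₂)
    (hD_sing : ∀ x : ℝ, 0 < x → c₁ * x ^ (-γ₁) ≤ D x (-δ₁))
    (hδ₂ : 0 < δ₂) (hγ_nonneg : ∀ y : ℝ, 0 < y → 0 ≤ γ y)
    (hγ_int : ∃ r : ℝ, 0 < r ∧ IntegrableOn (fun y => γ y * y⁻¹) (Ioc 0 r))
    (hγ_lim : Tendsto (fun h : ℝ => ∫ y in (0 : ℝ)..h, γ y * y⁻¹) (𝓝[>] 0) (𝓝 0))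
    (hD_upper : ∀ x : ℝ, 0 < x → D x (-δ₂) ≤ γ x * x ^ (-γ₁))
    (hδ : δ₂ < δ) (hk : 0 < k) (hk' : k ^ 2 + 2 * a * elasticPotential b (-δ) ≤ v₀ ^ 2)
    (hκ : 0 < κ) (hκ' : ∀ x y, y ^ 2 + 2 * a * elasticPotential b x = v₀ ^ 2 →
      κ * (x ^ 2 + y ^ 2) ≤ a * b x * x + y ^ 2)
    (hT : -h₀ / v₀ + Real.pi / κ + δ / k < T) : h T ≠ 0 := by
  intro hT0
  have ha := H.a_pos
  have hV := H.V_pos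
  set p := -h₀ / v₀ with hp
  have hp0 : 0 < p := div_pos_of_neg_of_neg (by linarith) hv₀
  have hπ : 0 < Real.pi / κ := div_pos Real.pi_pos hκ
  have hδk : 0 < δ / k := div_pos (by linarith) hk
  have flight : ∀ t ∈ Icc 0 p, ξ t = 0 ∧ u t = v₀ ∧ h t = h₀ + v₀ * t :=
    fun t ht => H.free_flight hh₀ hv₀ ht
  obtain ⟨hξp, hup, hhp⟩ := flight p (right_mem_Icc.2 hp0.le)
  have hhp0 : h p = 0 := by
    rw [hhp, hp, mul_div_cancel₀ _ hv₀.ne]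
    ring
  obtain ⟨S, hS, hrest, hleave⟩ := H.exists_rest_time (T := T) hp0.le (by linarith) hhp0
  have hS0 : 0 < S := hp0.trans_le hS.1
  have O := H.isWallOscillation hp0.le hS.1 hξp hup hrest
  -- while the body rests, the deformation stays above `-δ`
  have hlow : ∀ t ∈ Icc p S, -δ < ξ t := by
    intro t ht
    by_contra hle
    push Not at hle
    obtain ⟨r, hr, hr0, hrpos⟩ := exists_first_zero (f := fun y => ξ y + δ) ht.1
      ((O.cont_ξ.mono (Icc_subset_Icc_right ht.2)).add continuousOn_const)
      (by simp only [hξp]; linarith) (by linarith)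
    have hrξ : ξ r = -δ := by linarith
    have Or := O.mono (r := r) ⟨hr.1.le, hr.2.trans ht.2⟩
    obtain ⟨s, hs, hs0, hspos, -, hdesc⟩ := Or.exists_descent ha H.b_cont H.b_sign hv₀ hk hk'
      (fun y hy => by
        rcases hy.2.eq_or_lt with h1 | h1
        · rw [h1, hrξ]
        · linarith [hrpos y ⟨hy.1, h1⟩]) (z := r) (right_mem_Ioc.2 hr.1) (by linarith)
    have hsr : s < r := lt_of_le_of_ne hs.2 (by rintro rfl; linarith)
    set η := min ((r - s) / 4) (min (δ₁ / (4 * V)) ((δ - δ₂) / (4 * V))) with hη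
    have hη0 : 0 < η := by
      have : 0 < δ - δ₂ := sub_pos.2 hδ
      simp only [hη, lt_min_iff]
      exact ⟨by linarith, by positivity, by positivity⟩
    have hη1 : η ≤ (r - s) / 4 := min_le_left _ _
    have hη2 : (V + V) * η ≤ δ₁ / 2 := by
      have : η ≤ δ₁ / (4 * V) := (min_le_right _ _).trans (min_le_left _ _)
      rw [le_div_iff₀ (by positivity)] at this
      linarith
    have hη3 : (V + V) * η ≤ (δ - δ₂) / 2 := by
      have : η ≤ (δ - δ₂) / (4 * V) := (min_le_right _ _).trans (min_le_right _ _)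
      rw [le_div_iff₀ (by positivity)] at this
      linarith
    have hs0' : 0 < s := hp0.trans hs.1
    refine H.false_of_stuck (δ₁ := δ₁) (δ₂ := δ₂) (σ := s + η / 2) (τ := s + η) (t₁ := r - η)
      (t₂ := r) hc₁ hγ₁ hD_mono hD_sing hγ_nonneg hγ_int hγ_lim hD_upper (by linarith)
      (by linarith) (by linarith) (by linarith)
      (fun y hy => hrest y ⟨by linarith [hy.1, hs.1], hy.2.trans (hr.2.trans ht.2)⟩) ?_ ?_ ?_
    · intro y hy
      rcases le_or_gt y p with h1 | h1
      · rw [(flight y ⟨hy.1, h1⟩).1]; linarith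
      · rcases lt_or_ge y s with h2 | h2
        · linarith [hspos y ⟨h1, h2⟩]
        · have h3 := (abs_le.1 (H.lip_ξ hs0'.le (hs0'.le.trans h2))).1
          rw [hs0, abs_of_nonneg (sub_nonneg.2 h2)] at h3
          have : (V + V) * (y - s) ≤ (V + V) * η :=
            mul_le_mul_of_nonneg_left (by linarith [hy.2]) (by positivity)
          linarith
    · intro y hy
      have h1 := hdesc y ⟨by linarith [hy.1], hy.2⟩
      have h2 : 0 < k * (y - s) := mul_pos hk (by linarith [hy.1])
      linarith
    · intro y hy
      have hy0 : 0 ≤ y := by linarith [hy.1]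
      have h3 := (abs_le.1 (H.lip_ξ (s := r) (hs0'.trans hsr).le hy0)).2
      rw [hrξ, abs_sub_comm, abs_of_nonneg (sub_nonneg.2 hy.2)] at h3
      have : (V + V) * (r - y) ≤ (V + V) * η :=
        mul_le_mul_of_nonneg_left (by linarith [hy.1]) (by positivity)
      linarith
  have descent : ∀ z ∈ Ioc p S, ξ z ≤ 0 → ∃ s ∈ Ioc p S, ξ s = 0 ∧ (∀ t ∈ Ioo p s, 0 < ξ t) ∧
      (∀ t ∈ Icc s S, k ≤ u t) ∧ ∀ t ∈ Icc s S, ξ t ≤ -k * (t - s) := fun z hz hz0 =>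
    O.exists_descent ha H.b_cont H.b_sign hv₀ hk hk' (fun t ht => (hlow t ht).le) hz hz0
  -- hence the rest ends before time `T`
  have hST : S < T := by
    by_cases hcase : ∃ z ∈ Ioc p S, ξ z ≤ 0
    · obtain ⟨z, hz, hz0⟩ := hcase
      obtain ⟨s, hs, -, hspos, -, hdesc⟩ := descent z hz hz0
      have h1 := (O.mono (r := s) ⟨hs.1.le, hs.2⟩).compression_time_le H.b_cont hκ hκ' hspos
      have h2 := hdesc S (right_mem_Icc.2 hs.2)
      have h3 := hlow S (right_mem_Icc.2 hS.1)
      have h4 : S - s < δ / k := by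
        rw [lt_div_iff₀ hk]
        linarith
      linarith
    · push Not at hcase
      have h1 := O.compression_time_le H.b_cont hκ hκ' fun t ht => hcase t ⟨ht.1, ht.2.le⟩
      linarith
  have hleave' := hleave.resolve_left hST.ne
  have hhS := hrest S (right_mem_Icc.2 hS.1)
  rcases le_or_gt (ξ S) 0 with hξS | hξS
  · rcases hS.1.eq_or_lt with hpS | hpS
    · -- right after the contact time the momentum of the center of mass compresses the spring
      obtain ⟨ε, hε, hεu⟩ := exists_pos_right (f := fun y => -u y) hp0.le H.continuousOn_u.neg
        (by simp only [hup]; linarith)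
      refine H.false_of_leaving_compressed hS0 hhS hleave' hε fun t ht => ?_
      rw [← hpS] at ht
      have hm : StrictAntiOn (fun y => h y - ξ y) (Icc p t) := by
        refine strictAntiOn_of_deriv_neg (convex_Icc p t)
          ((H.continuousOn_h.sub H.continuousOn_ξ).mono fun y hy => hp0.le.trans hy.1) ?_
        intro y hy
        rw [interior_Icc] at hy
        rw [(H.hasDerivAt_sub (hp0.trans hy.1)).deriv]
        linarith [hεu y ⟨hy.1.le, by linarith [hy.2, ht.2]⟩]
      have h1 := hm (left_mem_Icc.2 ht.1.le) (right_mem_Icc.2 ht.1.le) ht.1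
      simp only [hhp0, hξp] at h1
      linarith [H.h_nonneg (hp0.le.trans ht.1.le)]
    · obtain ⟨s, hs, -, -, hsu, -⟩ := descent S (right_mem_Ioc.2 hpS) hξS
      exact H.false_of_leaving_descending hS0 hhS hT0 hleave'
        (hk.trans_le (hsu S (right_mem_Icc.2 hs.2)))
  · obtain ⟨ε, hε, hεξ⟩ := exists_pos_right hS0.le H.continuousOn_ξ hξS
    exact H.false_of_leaving_compressed hS0 hhS hleave' hε fun t ht => hεξ t ⟨ht.1.le, ht.2.le⟩

end IsVanishingLimit

/-! ### Positive lower limit -/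

lemma exists_eventually_le_of_ultrafilter {x : ℕ → ℝ} (hx : ∀ n, 0 ≤ x n)
    (hU : ∀ U : Ultrafilter ℕ, (U : Filter ℕ) ≤ atTop → ¬ Tendsto x U (𝓝 0)) :
    ∃ ε : ℝ, 0 < ε ∧ ∀ᶠ n in atTop, ε ≤ x n := by
  have h0 : ¬ MapClusterPt 0 atTop x := by
    rw [mapClusterPt_iff_ultrafilter]
    rintro ⟨U, hle, hlim⟩
    exact hU U hle hlim
  rw [mapClusterPt_iff_frequently] at h0
  push Not at h0
  obtain ⟨s, hs, hs'⟩ := h0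
  obtain ⟨ε, hε, hball⟩ := Metric.mem_nhds_iff.1 hs
  refine ⟨ε, hε, ?_⟩
  filter_upwards [hs'] with n hn
  by_contra hlt
  refine hn (hball ?_)
  rw [Metric.mem_ball, Real.dist_eq, sub_zero, abs_of_nonneg (hx n)]
  exact not_le.1 hlt

lemma exists_subseq_tendsto_pos {x : ℕ → ℝ} {ε M : ℝ} (hε : 0 < ε)
    (h1 : ∀ᶠ n in atTop, ε ≤ x n) (h2 : ∀ n, x n ≤ M) :
    ∃ (φ : ℕ → ℕ) (L : ℝ), StrictMono φ ∧ 0 < L ∧ Tendsto (fun k => x (φ k)) atTop (𝓝 L) := by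
  obtain ⟨L, hL, φ, hφ, hlim⟩ := (isCompact_Icc (a := ε) (b := M)).tendsto_subseq'
    (x := x) (h1.mono fun n hn => ⟨hn, h2 n⟩).frequently
  exact ⟨φ, L, hφ, hε.trans_le hL.1, hlim⟩

theorem theorem3p3
    (a h₀ v₀ : ℝ) (ha : 0 < a) (hh₀ : 0 < h₀) (hv₀ : v₀ ≠ 0)
    -- the elastic response
    (b : ℝ → ℝ) (hb_lip : LocallyLipschitz b)
    (hB_coercive : Tendsto (elasticPotential b) (cocompact ℝ) atTop)
    (hb_sign : ∀ y : ℝ, y ≠ 0 → 0 < b y * y)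
    -- the drag shape factor
    (D : ℝ → ℝ → ℝ)
    (hD_lip : LocallyLipschitzOn (Ioi (0 : ℝ) ×ˢ (univ : Set ℝ)) (fun p : ℝ × ℝ => D p.1 p.2))
    (c α : ℝ) (hc : 0 < c) (hα : 1 ≤ α)
    (hD_lower : ∀ h ξ : ℝ, 0 < h → c * h ^ (-α) ≤ D h ξ)
    (hD_mono : ∀ h : ℝ, 0 < h → ∀ ξ₁ ξ₂ : ℝ, ξ₁ ≤ ξ₂ → D h ξ₁ ≤ D h ξ₂)
    (δ₁ c₁ γ₁ : ℝ) (hδ₁ : 0 < δ₁) (hc₁ : 0 < c₁) (hγ₁ : α ≤ γ₁)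
    (hD_sing : ∀ h : ℝ, 0 < h → c₁ * h ^ (-γ₁) ≤ D h (-δ₁))
    (δ₂ : ℝ) (hδ₂ : 0 < δ₂) (γ : ℝ → ℝ) (hγ_nonneg : ∀ y : ℝ, 0 < y → 0 ≤ γ y)
    (hγ_int : ∃ r : ℝ, 0 < r ∧ IntegrableOn (fun y => γ y * y⁻¹) (Ioc 0 r))
    (hγ_lim : Tendsto (fun h : ℝ => ∫ y in (0 : ℝ)..h, γ y * y⁻¹) (𝓝[>] 0) (𝓝 0))
    (hD_upper : ∀ h : ℝ, 0 < h → D h (-δ₂) ≤ γ h * h ^ (-γ₁)) :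
    (∃! y : ℝ, y < 0 ∧ 2 * a * elasticPotential b y = v₀ ^ 2) ∧
    ∀ y : ℝ, y < 0 → 2 * a * elasticPotential b y = v₀ ^ 2 → y < -δ₂ →
      ∀ (μ : ℕ → ℝ) (h ξ : ℕ → ℝ → ℝ),
        (∀ n, 0 < μ n) → Tendsto μ atTop (𝓝 0) →
        (∀ n, IsGlobalSolution a (μ n) b D h₀ v₀ 0 0 (h n) (ξ n)) →
        ∃ T : ℝ, 0 < T ∧ -h₀ / v₀ < T ∧
          -- the lower limit of the whole sequence at time `T` is positive
          (∃ ε : ℝ, 0 < ε ∧ ∀ᶠ n in atTop, ε ≤ h n T) ∧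
          -- and a positive limit is attained along a subsequence
          (∃ (φ : ℕ → ℕ) (L : ℝ), StrictMono φ ∧ 0 < L ∧
            Tendsto (fun k => h (φ k) T) atTop (𝓝 L)) := by
  have hb := hb_lip.continuous
  have hD_pos : ∀ x y : ℝ, 0 < x → 0 < D x y := fun x y hx =>
    (mul_pos hc (Real.rpow_pos_of_pos hx _)).trans_le (hD_lower x y hx)
  refine ⟨existsUnique_neg_elasticPotential_eq hb hb_sign hB_coercive ha hv₀, ?_⟩
  intro y hy hyE hyδ μ h ξ hμ hμ0 hsol
  choose v u traj using fun n => (hsol n).exists_isTrajectory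
  obtain ⟨V, X, C, hV, hX, hC, hbC, hbd⟩ :=
    IsTrajectory.exists_uniform_bounds ha hb hb_sign hB_coercive hD_pos h₀ v₀
  have hbd' := fun n => hbd (μ n) (hμ n) _ _ _ _ (traj n)
  have hLip : ∀ n t, 0 ≤ t → |h n t - h₀| ≤ V * t := by
    intro n t ht
    have := abs_sub_le_of_hasDerivWithinAt (traj n).deriv_h (fun s hs => (hbd' n s hs).1) le_rfl ht
    rwa [(traj n).h_zero, sub_zero, abs_of_nonneg ht] at this
  suffices hT : ∃ T : ℝ, 0 < T ∧ -h₀ / v₀ < T ∧ ∃ ε : ℝ, 0 < ε ∧ ∀ᶠ n in atTop, ε ≤ h n T by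
    obtain ⟨T, hT0, hT1, ε, hε, hev⟩ := hT
    exact ⟨T, hT0, hT1, ⟨ε, hε, hev⟩, exists_subseq_tendsto_pos hε hev (M := h₀ + V * T)
      fun n => by linarith [(abs_le.1 (hLip n T hT0.le)).2]⟩
  rcases hv₀.lt_or_gt with hneg | hpos
  · obtain ⟨κ, hκ, hκ'⟩ := exists_angular_speed ha hv₀ hb hb_sign hB_coercive
    -- a deformation `-δ` strictly between `y` and `-δ₂` is passed with positive speed `k`
    set δ := (δ₂ - y) / 2 with hδ
    have hδ1 : δ₂ < δ := by linarith
    have hBδ : 2 * a * elasticPotential b (-δ) < v₀ ^ 2 := by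
      rw [← hyE]
      have : elasticPotential b (-δ) < elasticPotential b y :=
        strictAntiOn_elasticPotential hb hb_sign hy.le
          (show -δ ≤ 0 by linarith) (by linarith)
      exact mul_lt_mul_of_pos_left this (by positivity)
    set k := Real.sqrt (v₀ ^ 2 - 2 * a * elasticPotential b (-δ)) with hk
    have hk0 : 0 < k := Real.sqrt_pos.2 (by linarith)
    have hk' : k ^ 2 + 2 * a * elasticPotential b (-δ) ≤ v₀ ^ 2 := by
      rw [hk, Real.sq_sqrt (by linarith)]
      linarith
    have hp0 : 0 < -h₀ / v₀ := div_pos_of_neg_of_neg (by linarith) hneg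
    have hπ : 0 < Real.pi / κ := div_pos Real.pi_pos hκ
    have hδk : 0 < δ / k := div_pos (by linarith) hk0
    refine ⟨-h₀ / v₀ + Real.pi / κ + δ / k + 1, by linarith, by linarith, ?_⟩
    set T := -h₀ / v₀ + Real.pi / κ + δ / k + 1 with hT
    have hT0 : 0 ≤ T := by linarith
    refine exists_eventually_le_of_ultrafilter (fun n => ((traj n).pos T hT0).le) ?_
    intro U hU hlim
    obtain ⟨hl, hhl⟩ := exists_tendsto_of_abs_le U (f := h) (M := fun t => h₀ + V * t)
      fun n t ht => by
        have h1 := abs_le.1 (hLip n t ht)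
        rw [abs_of_pos ((traj n).pos t ht)]
        linarith
    obtain ⟨ξl, hξl⟩ := exists_tendsto_of_abs_le U (f := ξ) (M := fun _ => X)
      fun n t ht => (hbd' n t ht).2.2
    obtain ⟨ul, hul⟩ := exists_tendsto_of_abs_le U (f := u) (M := fun _ => V)
      fun n t ht => (hbd' n t ht).2.1
    have H : IsVanishingLimit a b D h₀ v₀ V X C U μ h ξ v u hl ξl ul :=
      { a_pos := ha
        V_pos := hV
        C_pos := hC
        μ_pos := hμ
        μ_tendsto := hμ0.mono_left hU
        traj := traj
        v_le := fun n t ht => (hbd' n t ht).1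
        u_le := fun n t ht => (hbd' n t ht).2.1
        ξ_le := fun n t ht => (hbd' n t ht).2.2
        b_le := hbC
        b_lip := hb_lip
        b_sign := hb_sign
        D_pos := hD_pos
        D_cont := hD_lip.continuousOn
        tendsto_h := hhl
        tendsto_ξ := hξl
        tendsto_u := hul }
    exact H.height_ne_zero hh₀ hneg hδ₁ hc₁ (hα.trans hγ₁) hD_mono hD_sing hδ₂ hγ_nonneg hγ_int
      hγ_lim hD_upper hδ1 hk0 hk' hκ hκ' (by linarith) (tendsto_nhds_unique (hhl T hT0) hlim)
  · -- the contact time is negative, and any short time will do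
    refine ⟨h₀ / (2 * V), by positivity, ?_, h₀ / 2, by positivity, Eventually.of_forall fun n => ?_⟩
    · exact (div_neg_of_neg_of_pos (by linarith) hpos).trans (by positivity)
    · have h1 := (abs_le.1 (hLip n (h₀ / (2 * V)) (by positivity))).1
      have h2 : V * (h₀ / (2 * V)) = h₀ / 2 := by field_simp
      linarith
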